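/- Let $M$ be a smooth manifold with an almost Norden structure $(J,g)$: $J$ is a smooth almost complex structure and $g$ a smooth pseudo-Riemannian metric with $g(JX,JY)=-g(X,Y)$ (so $g$ has neutral signature). Let $\nabla$ be the Levi-Civita connection of $g$, and let $X^H$, $X^V$ denote the horizontal lift (with respect to $\nabla$) and the vertical lift of $X$ to the tangent bundle $TM$. Equip $TM$ with the almost complex structures $$J_1:\ X^H\mapsto-(JX)^H,\ X^V\mapsto(JX)^V;\qquad J_2:\ X^H\mapsto X^V,\ X^V\mapsto-X^H;\qquad J_3:\ X^H\mapsto(JX)^V,\ X^V\mapsto(JX)^H,$$ and with the complete lift $\hat g$ of $g$, that is $$\hat g(X^H,Y^H)=\hat g(X^V,Y^V)=0,\qquad \hat g(X^H,Y^V)=\hat g(X^V,Y^H)=g(X,Y).$$ For a pseudo-Riemannian metric $h$ with Levi-Civita connection $D$ and an almost complex structure $K$ put $F(x,y,z)=h((D_xK)y,z)$, and let the Lee form be $\theta(z)=h^{ij}F(e_i,e_j,z)$, for any basis $(e_i)$ of the tangent space. The pair $(K,h)$ is almost Hermitian if $h(Kx,Ky)=h(x,y)$ and almost Norden if $h(Kx,Ky)=-h(x,y)$.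 An almost Hermitian pair is semi-Kähler ($\mathcal{SK}$) if $\theta=0$, and almost Kähler ($\mathcal{AK}$) if the 2-form $h(K\cdot,\cdot)$ is closed. An almost Norden pair is Kähler–Norden ($\mathcal W_0$) if $DK=0$, and lies in $\mathcal W_2\oplus\mathcal W_3$ if $\theta=0$. Then: (i) If $g$ is flat, then $J_2$ is parallel with respect to the Levi-Civita connection of $\hat g$. (ii) If $g$ is flat and the Lee form of $(J,g)$ vanishes, i.e. $(M,J,g)\in\mathcal W_2\oplus\mathcal W_3$, then $(TM,J_1,\hat g)\in\mathcal{SK}$, $(TM,J_2,\hat g)\in\mathcal W_0$ and $(TM,J_3,\hat g)\in\mathcal W_2\oplus\mathcal W_3$. (iii) If $(M,J,g)$ is Kähler–Norden, then $(TM,J_1,\hat g)\in\mathcal{AK}$. -/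

import Mathlib

open Bundle Manifold VectorField FiberBundle
open scoped ContDiff Topology

noncomputable section

section General

variable {E : Type*} [NormedAddCommGroup E] [NormedSpace ℝ E]
  {H : Type*} [TopologicalSpace H] (I : ModelWithCorners ℝ E H)
  (M : Type*) [TopologicalSpace M] [ChartedSpace H M]

/-- A field of bilinear forms on the tangent spaces: a (0,2)-tensor field, no smoothness required. -/
abbrev BilinField : Type _ := ∀ x : M, TangentSpace I x →L[ℝ] TangentSpace I x →L[ℝ] ℝ

/-- A field of endomorphisms of the tangent spaces: a (1,1)-tensor field, no smoothness required. -/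
abbrev EndoField : Type _ := ∀ x : M, TangentSpace I x →L[ℝ] TangentSpace I x

/-- The type of operators `Y ↦ (x ↦ (v ↦ (∇_v Y)(x)))`, with Mathlib's order of arguments: `cov Y x v`
is `∇_v Y` at `x`. -/
abbrev Connection : Type _ :=
  (Π x : M, TangentSpace I x) → (Π x : M, TangentSpace I x →L[ℝ] TangentSpace I x)

variable {I M}

/-- The (0,2)-tensor field `g` is a `C^∞` section of the bundle of bilinear forms. -/
def BilinField.IsSmooth [IsManifold I ∞ M] (g : BilinField I M) : Prop :=
  ContMDiff I (I.prod 𝓘(ℝ, E →L[ℝ] E →L[ℝ] ℝ)) ∞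
    (fun x ↦ TotalSpace.mk' (E →L[ℝ] E →L[ℝ] ℝ)
      (E := fun x : M ↦ TangentSpace I x →L[ℝ] TangentSpace I x →L[ℝ] ℝ) x (g x))

/-- The (1,1)-tensor field `J` is a `C^∞` section of the endomorphism bundle. -/
def EndoField.IsSmooth [IsManifold I ∞ M] (J : EndoField I M) : Prop :=
  ContMDiff I (I.prod 𝓘(ℝ, E →L[ℝ] E)) ∞
    (fun x ↦ TotalSpace.mk' (E →L[ℝ] E)
      (E := fun x : M ↦ TangentSpace I x →L[ℝ] TangentSpace I x) x (J x))

/-- `g` is a pseudo-Riemannian metric. -/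
structure IsMetric [IsManifold I ∞ M] (g : BilinField I M) : Prop where
  smooth : g.IsSmooth
  symm : ∀ (x : M) (v w : TangentSpace I x), g x v w = g x w v
  nondegenerate : ∀ (x : M) (v : TangentSpace I x), (∀ w, g x v w = 0) → v = 0

/-- `cov` is a torsion-free covariant derivative compatible with `g`. -/
structure IsLeviCivita [IsManifold I ∞ M] (g : BilinField I M) (cov : Connection I M) : Prop where
  isCovariantDerivative : IsCovariantDerivativeOn E cov
  torsionFree : ∀ {X Y : Π x : M, TangentSpace I x} {x : M},
    MDiffAt (T% X) x → MDiffAt (T% Y) x →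
      cov Y x (X x) - cov X x (Y x) = mlieBracket I X Y x
  metric : ∀ {Y Z : Π x : M, TangentSpace I x} {x : M},
    MDiffAt (T% Y) x → MDiffAt (T% Z) x → ∀ v : TangentSpace I x,
      d% (fun y ↦ g y (Y y) (Z y)) x v = g x (cov Y x v) (Z x) + g x (Y x) (cov Z x v)

/-- The right-hand side of the Koszul formula for `2 g(∇_X Y, Z)`. -/
def koszul (g : BilinField I M) (X Y Z : Π x : M, TangentSpace I x) (x : M) : ℝ :=
  d% (fun y ↦ g y (Y y) (Z y)) x (X x) + d% (fun y ↦ g y (X y) (Z y)) x (Y x)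
    - d% (fun y ↦ g y (X y) (Y y)) x (Z x)
    + g x (mlieBracket I X Y x) (Z x) - g x (mlieBracket I X Z x) (Y x)
    - g x (mlieBracket I Y Z x) (X x)

variable [IsManifold I ∞ M]

theorem BilinField.IsSmooth.mdiffAt {g : BilinField I M} (hg : g.IsSmooth)
    {Y Z : Π x : M, TangentSpace I x} {x : M}
    (hY : MDiffAt (T% Y) x) (hZ : MDiffAt (T% Z) x) :
    MDiffAt (fun y ↦ g y (Y y) (Z y)) x := by
  have h : MDiffAt (fun m ↦ TotalSpace.mk' (E →L[ℝ] E →L[ℝ] ℝ)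
      (E := fun x : M ↦ TangentSpace I x →L[ℝ] TangentSpace I x →L[ℝ] ℝ) m (g m)) x :=
    (hg x).mdifferentiableAt (by simp)
  have := MDifferentiableAt.clm_bundle_apply₂ (b := fun x : M ↦ x) (F₃ := ℝ)
     (E₃ := Bundle.Trivial M ℝ) h hY hZ
  simp only [mdifferentiableAt_totalSpace] at this
  exact this.2

theorem IsMetric.ext {g : BilinField I M} (hg : IsMetric g) {x : M} {v w : TangentSpace I x}
    (h : ∀ z, g x v z = g x w z) : v = w := by
  refine sub_eq_zero.1 (hg.nondegenerate x _ fun z ↦ ?_)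
  simp [h z]

variable [FiniteDimensional ℝ E]

theorem koszul_tensorial_left {g : BilinField I M} (hg : IsMetric g)
    {Y Z : Π x : M, TangentSpace I x} {x : M}
    (hY : MDiffAt (T% Y) x) (hZ : MDiffAt (T% Z) x) :
    TensorialAt I E (fun X ↦ koszul g X Y Z x) x where
  smul {f X} hf hX := by
    have := FiniteDimensional.complete ℝ E
    have e1 : (fun y ↦ g y ((f • X) y) (Z y)) = f * (fun y ↦ g y (X y) (Z y)) := by
      ext y; simp
    have e2 : (fun y ↦ g y ((f • X) y) (Y y)) = f * (fun y ↦ g y (X y) (Y y)) := by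
      ext y; simp
    simp only [koszul]
    rw [e1, e2, mvfderiv_mul hf (hg.smooth.mdiffAt hX hZ), mvfderiv_mul hf (hg.smooth.mdiffAt hX hY),
      mlieBracket_smul_left hf hX, mlieBracket_smul_left hf hX]
    simp
    ring
  add {X X'} hX hX' := by
    have := FiniteDimensional.complete ℝ E
    have e1 : (fun y ↦ g y ((X + X') y) (Z y)) =
      (fun y ↦ g y (X y) (Z y)) + (fun y ↦ g y (X' y) (Z y)) := by
      ext y; simp
    have e2 : (fun y ↦ g y ((X + X') y) (Y y)) =
      (fun y ↦ g y (X y) (Y y)) + (fun y ↦ g y (X' y) (Y y)) := by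
      ext y; simp
    simp only [koszul]
    rw [e1, e2, mvfderiv_add (hg.smooth.mdiffAt hX hZ) (hg.smooth.mdiffAt hX' hZ),
      mvfderiv_add (hg.smooth.mdiffAt hX hY) (hg.smooth.mdiffAt hX' hY),
      mlieBracket_add_left hX hX', mlieBracket_add_left hX hX']
    simp
    ring

theorem koszul_tensorial_right {g : BilinField I M} (hg : IsMetric g)
    {X Y : Π x : M, TangentSpace I x} {x : M}
    (hX : MDiffAt (T% X) x) (hY : MDiffAt (T% Y) x) :
    TensorialAt I E (fun Z ↦ koszul g X Y Z x) x where
  smul {f Z} hf hZ := by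
    have := FiniteDimensional.complete ℝ E
    have e1 : (fun y ↦ g y (Y y) ((f • Z) y)) = f * (fun y ↦ g y (Y y) (Z y)) := by
      ext y; simp
    have e2 : (fun y ↦ g y (X y) ((f • Z) y)) = f * (fun y ↦ g y (X y) (Z y)) := by
      ext y; simp
    simp only [koszul]
    rw [e1, e2, mvfderiv_mul hf (hg.smooth.mdiffAt hY hZ), mvfderiv_mul hf (hg.smooth.mdiffAt hX hZ),
      mlieBracket_smul_right hf hZ, mlieBracket_smul_right hf hZ]
    simp
    rw [hg.symm x (Z x) (Y x), hg.symm x (Z x) (X x)]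
    ring
  add {Z Z'} hZ hZ' := by
    have := FiniteDimensional.complete ℝ E
    have e1 : (fun y ↦ g y (Y y) ((Z + Z') y)) =
      (fun y ↦ g y (Y y) (Z y)) + (fun y ↦ g y (Y y) (Z' y)) := by
      ext y; simp
    have e2 : (fun y ↦ g y (X y) ((Z + Z') y)) =
      (fun y ↦ g y (X y) (Z y)) + (fun y ↦ g y (X y) (Z' y)) := by
      ext y; simp
    simp only [koszul]
    rw [e1, e2, mvfderiv_add (hg.smooth.mdiffAt hY hZ) (hg.smooth.mdiffAt hY hZ'),
      mvfderiv_add (hg.smooth.mdiffAt hX hZ) (hg.smooth.mdiffAt hX hZ'),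
      mlieBracket_add_right hZ hZ', mlieBracket_add_right hZ hZ']
    simp
    ring

theorem exists_sharp {F : Type*} [NormedAddCommGroup F] [NormedSpace ℝ F]
    [FiniteDimensional ℝ F] (f : F →L[ℝ] F →L[ℝ] ℝ) (hf : ∀ v, (∀ w, f v w = 0) → v = 0) :
    ∃ S : (F →L[ℝ] ℝ) →L[ℝ] F, ∀ φ z, f (S φ) z = φ z := by
  have hinj : Function.Injective (f : F →ₗ[ℝ] (F →L[ℝ] ℝ)) := by
    rw [injective_iff_map_eq_zero]
    intro v hv
    exact hf v fun w ↦ by simpa using congr($hv w)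
  have hfr : Module.finrank ℝ F = Module.finrank ℝ (F →L[ℝ] ℝ) := by
    rw [← (LinearMap.toContinuousLinearMap (𝕜 := ℝ) (E := F) (F' := ℝ)).finrank_eq]
    exact (Subspace.dual_finrank_eq (K := ℝ) (V := F)).symm
  let e := LinearEquiv.ofBijective (f : F →ₗ[ℝ] (F →L[ℝ] ℝ))
    ⟨hinj, (LinearMap.injective_iff_surjective_of_finrank_eq_finrank hfr).1 hinj⟩
  refine ⟨e.symm.toLinearMap.toContinuousLinearMap, fun φ z ↦ ?_⟩
  have : e (e.symm φ) = φ := e.apply_symm_apply φ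
  exact congr($this z)

theorem IsMetric.exists_connection {g : BilinField I M} (hg : IsMetric g) :
    ∃ cov : Connection I M, ∀ {X Y Z : Π x : M, TangentSpace I x} {x : M},
      MDiffAt (T% X) x → MDiffAt (T% Y) x → MDiffAt (T% Z) x →
        2 * g x (cov Y x (X x)) (Z x) = koszul g X Y Z x := by
  classical
  have hS : ∀ x : M, ∃ S : (TangentSpace I x →L[ℝ] ℝ) →L[ℝ] TangentSpace I x,
      ∀ φ z, g x (S φ) z = φ z := fun x ↦
    exists_sharp (F := E) (g x) (hg.nondegenerate x)
  choose S hS using hS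
  let cov : Connection I M := fun Y x ↦
    if hY : MDiffAt (T% Y) x then
      (1 / 2 : ℝ) • S x ∘L TensorialAt.mkHom₂ (I := I) (F := E) (F' := E) (V := TangentSpace I)
        (V' := TangentSpace I) (fun X Z ↦ koszul g X Y Z x) x
        (fun _ hZ ↦ koszul_tensorial_left hg hY hZ) (fun _ hX ↦ koszul_tensorial_right hg hX hY)
    else 0
  refine ⟨cov, fun {X Y Z x} hX hY hZ ↦ ?_⟩
  simp only [cov, dif_pos hY, smul_apply, ContinuousLinearMap.comp_apply,
    map_smul, hS, smul_eq_mul]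
  rw [TensorialAt.mkHom₂_apply _ _ hX hZ]
  ring

/-- The fundamental theorem of pseudo-Riemannian geometry. -/
theorem IsMetric.exists_isLeviCivita {g : BilinField I M} (hg : IsMetric g) :
    ∃ cov, IsLeviCivita g cov := by
  have := FiniteDimensional.complete ℝ E
  obtain ⟨cov, hcov⟩ := hg.exists_connection
  have key : ∀ {Y : Π x : M, TangentSpace I x} {x : M}, MDiffAt (T% Y) x →
      ∀ v z : TangentSpace I x,
        2 * g x (cov Y x v) z = koszul g (extend E v) Y (extend E z) x := by
    intro Y x hY v z
    simpa using hcov (mdifferentiableAt_extend I E v) hY (mdifferentiableAt_extend I E z)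
  refine ⟨cov, ⟨⟨?_, ?_⟩, ?_, ?_⟩⟩
  · intro Y Y' x hY hY' _
    ext v
    refine hg.ext fun z ↦ ?_
    have hv := mdifferentiableAt_extend I E v
    have hz := mdifferentiableAt_extend I E z
    have e1 : (fun y ↦ g y ((Y + Y') y) (extend E z y)) =
      (fun y ↦ g y (Y y) (extend E z y)) + (fun y ↦ g y (Y' y) (extend E z y)) := by
      ext y; simp
    have e2 : (fun y ↦ g y (extend E v y) ((Y + Y') y)) =
      (fun y ↦ g y (extend E v y) (Y y)) + (fun y ↦ g y (extend E v y) (Y' y)) := by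
      ext y; simp
    have h := key (mdifferentiableAt_add_section hY hY') v z
    have h1 := key hY v z
    have h2 := key hY' v z
    simp only [koszul] at h h1 h2
    rw [e1, e2, mvfderiv_add (hg.smooth.mdiffAt hY hz) (hg.smooth.mdiffAt hY' hz),
      mvfderiv_add (hg.smooth.mdiffAt hv hY) (hg.smooth.mdiffAt hv hY'),
      mlieBracket_add_left hY hY', mlieBracket_add_right hY hY'] at h
    simp at h h1 h2 ⊢
    linarith
  · intro Y f x hY hf _
    ext v
    refine hg.ext fun z ↦ ?_
    have hv := mdifferentiableAt_extend I E v
    have hz := mdifferentiableAt_extend I E z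
    have e1 : (fun y ↦ g y ((f • Y) y) (extend E z y)) =
      f * (fun y ↦ g y (Y y) (extend E z y)) := by
      ext y; simp
    have e2 : (fun y ↦ g y (extend E v y) ((f • Y) y)) =
      f * (fun y ↦ g y (extend E v y) (Y y)) := by
      ext y; simp
    have h := key (hf.smul_section hY) v z
    have h1 := key hY v z
    simp only [koszul] at h h1
    rw [e1, e2, mvfderiv_mul hf (hg.smooth.mdiffAt hY hz),
      mvfderiv_mul hf (hg.smooth.mdiffAt hv hY),
      mlieBracket_smul_left hf hY, mlieBracket_smul_right hf hY] at h
    simp at h h1 ⊢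
    rw [hg.symm x (Y x) v] at h
    linear_combination (1/2) * h - (f x / 2) * h1
  · intro X Y x hX hY
    refine hg.ext fun z ↦ ?_
    have hz := mdifferentiableAt_extend I E z
    have h1 := hcov hX hY hz
    have h2 := hcov hY hX hz
    have e : (fun y ↦ g y (X y) (Y y)) = (fun y ↦ g y (Y y) (X y)) := by
      ext y; exact hg.symm y _ _
    simp only [koszul] at h1 h2
    rw [e] at h1
    rw [mlieBracket_swap_apply (V := Y) (W := X)] at h2
    simp at h1 h2 ⊢
    linear_combination (1/2) * h1 - (1/2) * h2
  · intro Y Z x hY hZ v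
    have hv := mdifferentiableAt_extend I E v
    have h1 := hcov hv hY hZ
    have h2 := hcov hv hZ hY
    have e : (fun y ↦ g y (Z y) (Y y)) = (fun y ↦ g y (Y y) (Z y)) := by
      ext y; exact hg.symm y _ _
    simp only [koszul] at h1 h2
    rw [e, mlieBracket_swap_apply (V := Z) (W := Y)] at h2
    rw [hg.symm x (Y x)]
    simp at h1 h2 ⊢
    linear_combination (-1/2) * h1 - (1/2) * h2


/-- The Levi-Civita connection of `g`. It exists for every metric, by `IsMetric.exists_isLeviCivita`. -/
def leviCivita (g : BilinField I M) : Connection I M :=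
  Classical.epsilon (IsLeviCivita g)

theorem IsMetric.isLeviCivita_leviCivita {g : BilinField I M} (hg : IsMetric g) :
    IsLeviCivita g (leviCivita g) :=
  Classical.epsilon_spec hg.exists_isLeviCivita

/-- The curvature `R(v,w)z = ∇_V ∇_W Z - ∇_W ∇_V Z - ∇_[V,W] Z` at `x`, where `V`, `W`, `Z` are the
vector fields, smooth near `x`, that Mathlib's `extend` attaches to the vectors `v`, `w`, `z`. -/
def curvature (g : BilinField I M) (x : M) (v w z : TangentSpace I x) : TangentSpace I x :=
  leviCivita g (fun y ↦ leviCivita g (extend E z) y (extend E w y)) x v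
    - leviCivita g (fun y ↦ leviCivita g (extend E z) y (extend E v y)) x w
    - leviCivita g (extend E z) x (mlieBracket I (extend E v) (extend E w) x)

/-- The metric `g` is flat: the curvature of its Levi-Civita connection vanishes. -/
def IsFlat (g : BilinField I M) : Prop :=
  ∀ (x : M) (v w z : TangentSpace I x), curvature g x v w z = 0

/-- `(∇_v J) y = ∇_v (J Y) - J (∇_v Y)` at `x`, where `Y` is the extension of `y` to a vector field. -/
def covDerivEndo (g : BilinField I M) (J : EndoField I M) (x : M) (v y : TangentSpace I x) :
    TangentSpace I x :=
  leviCivita g (fun q ↦ J q (extend E y q)) x v - J x (leviCivita g (extend E y) x v)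

/-- `∇ J = 0` for the Levi-Civita connection `∇` of `g`. -/
def IsParallel (g : BilinField I M) (J : EndoField I M) : Prop :=
  ∀ (x : M) (v y : TangentSpace I x), covDerivEndo g J x v y = 0

/-- The structure tensor `F(v,y,z) = g((∇_v J) y, z)`. -/
def structureTensor (g : BilinField I M) (J : EndoField I M) (x : M)
    (v y z : TangentSpace I x) : ℝ :=
  g x (covDerivEndo g J x v y) z

/-- The Lee form `θ(z) = ∑ i j, g^{ij} F(e_i, e_j, z)`, where `(e_i)` is a basis of the tangent space
and `(g^{ij})` is the inverse of the Gram matrix `(g(e_i, e_j))`. The value does not depend on the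
basis. -/
def leeForm (g : BilinField I M) (J : EndoField I M) (x : M) (z : TangentSpace I x) : ℝ :=
  let e : Module.Basis (Fin (Module.finrank ℝ E)) ℝ (TangentSpace I x) := Module.finBasis ℝ E
  let G : Matrix (Fin (Module.finrank ℝ E)) (Fin (Module.finrank ℝ E)) ℝ :=
    Matrix.of fun i j ↦ g x (e i) (e j)
  ∑ i, ∑ j, G⁻¹ i j * structureTensor g J x (e i) (e j) z

/-- The (0,2)-tensor field `g(J ·, ·)`. -/
def twoForm (g : BilinField I M) (J : EndoField I M) : BilinField I M :=
  fun x ↦ (g x).comp (J x)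

/-- The exterior derivative of a 2-form: `dη(U,V,W) = U η(V,W) - V η(U,W) + W η(U,V)
- η([U,V],W) + η([U,W],V) - η([V,W],U)` at `x`. -/
def extDerivTwo (η : BilinField I M) (x : M) (u v w : TangentSpace I x) : ℝ :=
  let U : Π y : M, TangentSpace I y := extend E u
  let V : Π y : M, TangentSpace I y := extend E v
  let W : Π y : M, TangentSpace I y := extend E w
  d% (fun y ↦ η y (V y) (W y)) x u - d% (fun y ↦ η y (U y) (W y)) x v
    + d% (fun y ↦ η y (U y) (V y)) x w
    - η x (mlieBracket I U V x) w + η x (mlieBracket I U W x) v - η x (mlieBracket I V W x) u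

/-- `(g, J)` is an almost Hermitian structure: `J` is an almost complex structure that acts as an
isometry of the (pseudo-Riemannian) metric `g`. -/
structure IsAlmostHermitian (g : BilinField I M) (J : EndoField I M) : Prop where
  isMetric : IsMetric g
  smooth : J.IsSmooth
  sq : ∀ (x : M) (v : TangentSpace I x), J x (J x v) = -v
  isometry : ∀ (x : M) (v w : TangentSpace I x), g x (J x v) (J x w) = g x v w

/-- `(g, J)` is an almost Norden structure: `J` is an almost complex structure that acts as an
anti-isometry of the (pseudo-Riemannian) metric `g`. The signature is then neutral. -/
structure IsAlmostNorden (g : BilinField I M) (J : EndoField I M) : Prop where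
  isMetric : IsMetric g
  smooth : J.IsSmooth
  sq : ∀ (x : M) (v : TangentSpace I x), J x (J x v) = -v
  antiIsometry : ∀ (x : M) (v w : TangentSpace I x), g x (J x v) (J x w) = -g x v w

/-- The class `SK` of semi-Kaehler manifolds: almost Hermitian with vanishing Lee form. -/
def IsSemiKahler (g : BilinField I M) (J : EndoField I M) : Prop :=
  IsAlmostHermitian g J ∧ ∀ (x : M) (z : TangentSpace I x), leeForm g J x z = 0

/-- The class `AK` of almost Kaehler manifolds: almost Hermitian with closed Kaehler form. -/
def IsAlmostKahler (g : BilinField I M) (J : EndoField I M) : Prop :=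
  IsAlmostHermitian g J ∧
    ∀ (x : M) (u v w : TangentSpace I x), extDerivTwo (twoForm g J) x u v w = 0

/-- The class `W₀` of Kaehler-Norden manifolds: almost Norden with parallel `J`. -/
def IsKahlerNorden (g : BilinField I M) (J : EndoField I M) : Prop :=
  IsAlmostNorden g J ∧ IsParallel g J

/-- The class `W₂ ⊕ W₃` of almost Norden manifolds: those with vanishing Lee form. -/
def IsNordenW₂W₃ (g : BilinField I M) (J : EndoField I M) : Prop :=
  IsAlmostNorden g J ∧ ∀ (x : M) (z : TangentSpace I x), leeForm g J x z = 0

end General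

section Tangent

variable {E : Type*} [NormedAddCommGroup E] [NormedSpace ℝ E]
  {H : Type*} [TopologicalSpace H] {I : ModelWithCorners ℝ E H}
  {M : Type*} [TopologicalSpace M] [ChartedSpace H M] [IsManifold I ∞ M]

/-- The vertical lift of `w ∈ T_p M` to `u ∈ T_p M`: the velocity at `t = 0` of the curve `u + t w`
in the tangent bundle. -/
def verticalLift (u : TangentBundle I M) (w : TangentSpace I u.1) : TangentSpace I.tangent u :=
  let D : TangentSpace 𝓘(ℝ, ℝ) (0 : ℝ) →L[ℝ] TangentSpace I.tangent u :=
    mfderiv 𝓘(ℝ, ℝ) I.tangent (fun t : ℝ ↦ (⟨u.1, u.2 + t • w⟩ : TangentBundle I M)) 0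
  D (1 : ℝ)

/-- The horizontal lift of `v ∈ T_p M` to `u ∈ T_p M` for the connection `∇`: if `U` is a vector field
with `U(p) = u`, considered as a map from `M` to the tangent bundle, it is `dU(v) - (∇_v U)^V`.
Here `D` is the differential `dU`. -/
def horizontalLift (cov : Connection I M) (u : TangentBundle I M) (v : TangentSpace I u.1) :
    TangentSpace I.tangent u :=
  let D : TangentSpace I u.1 →L[ℝ] TangentSpace I.tangent u :=
    mfderiv I I.tangent (fun q : M ↦ (⟨q, extend E u.2 q⟩ : TangentBundle I M)) u.1
  D v - verticalLift u (cov (extend E u.2) u.1 v)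

theorem trivializationAt_snd (p : M) (w : TangentSpace I p) :
    (trivializationAt E (TangentSpace I) p (⟨p, w⟩ : TangentBundle I M)).2 = w := by
  rw [TangentBundle.trivializationAt_apply]
  exact tangentCoordChange_self (I := I) (x := p) (z := p) (v := w) (mem_extChartAt_source p)

theorem extChartAt_mk (u : TangentBundle I M) (p q : M) (w : TangentSpace I q) (hu : u.1 = p) :
    extChartAt I.tangent u (⟨q, w⟩ : TangentBundle I M) =
    (extChartAt I p q, (trivializationAt E (TangentSpace I) p (⟨q, w⟩ : TangentBundle I M)).2) := by
  subst hu
  rw [ModelWithCorners.tangent, FiberBundle.extChartAt]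
  rfl

theorem hasDerivAt_line {F : Type*} [NormedAddCommGroup F] [NormedSpace ℝ F] (c a b : F) :
    HasDerivAt (fun t : ℝ ↦ (c, a + t • b)) (0, b) 0 := by
  refine (hasDerivAt_const _ _).prodMk ?_
  simpa using ((hasDerivAt_id (0 : ℝ)).smul_const b).const_add a

theorem verticalLift_eq (u : TangentBundle I M) (w : TangentSpace I u.1) :
    verticalLift u w = ((0, w) : E × E) := by
  have e : (fun t : ℝ ↦ (trivializationAt E (TangentSpace I) u.1
      (⟨u.1, u.2 + t • w⟩ : TangentBundle I M)).2) = fun t ↦ (u.2 : E) + t • (w : E) := by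
    ext t
    exact trivializationAt_snd _ _
  have hd : MDifferentiableAt 𝓘(ℝ, ℝ) I.tangent
      (fun t : ℝ ↦ (⟨u.1, u.2 + t • w⟩ : TangentBundle I M)) 0 := by
    refine (mdifferentiableAt_totalSpace (IB := I) _).2 ⟨mdifferentiableAt_const, ?_⟩
    rw [e]
    exact (hasDerivAt_line (F := E) (u.2 : E) (u.2 : E) (w : E)).differentiableAt.snd.mdifferentiableAt
  have hw : writtenInExtChartAt 𝓘(ℝ, ℝ) I.tangent 0
      (fun t : ℝ ↦ (⟨u.1, u.2 + t • w⟩ : TangentBundle I M)) =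
      fun t ↦ ((extChartAt I u.1 u.1, (u.2 : E) + t • (w : E)) : E × E) := by
    ext1 t
    refine (extChartAt_mk _ u.1 u.1 _ rfl).trans ?_
    exact congrArg (Prod.mk _) (congrFun e t)
  have h1 : HasDerivAt (fun t : ℝ ↦ ((extChartAt I u.1 u.1, (u.2 : E) + t • (w : E)) : E × E))
      (0, (w : E)) 0 := hasDerivAt_line (F := E) _ _ _
  have h2 := hd.mfderiv
  rw [hw] at h2
  have h3 := congrArg (fun L : ℝ →L[ℝ] E × E ↦ L 1) h2
  refine h3.trans ?_
  simp only [ModelWithCorners.range_eq_univ, fderivWithin_univ]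
  exact h1.deriv

theorem sectionLift_fst (u : TangentBundle I M) (v : TangentSpace I u.1) :
    ((mfderiv I I.tangent (fun q : M ↦ (⟨q, extend E u.2 q⟩ : TangentBundle I M)) u.1 :
      E →L[ℝ] E × E) v).1 = v := by
  have hd : MDifferentiableAt I I.tangent
      (fun q : M ↦ (⟨q, extend E u.2 q⟩ : TangentBundle I M)) u.1 :=
    mdifferentiableAt_extend I E u.2
  have h2 := hd.mfderiv
  have hd2 : DifferentiableWithinAt ℝ (writtenInExtChartAt I I.tangent u.1
      (fun q : M ↦ (⟨q, extend E u.2 q⟩ : TangentBundle I M))) (Set.range I)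
      (extChartAt I u.1 u.1) := by
    have := hd.differentiableWithinAt_writtenInExtChartAt
    exact this
  have h3 := congrArg (fun L : E →L[ℝ] E × E ↦ (L v).1) h2
  refine h3.trans ?_
  have h4 := hd2.hasFDerivWithinAt.fst
  have h5 : HasFDerivWithinAt (fun z : E ↦ z) (ContinuousLinearMap.id ℝ E) (Set.range I)
      (extChartAt I u.1 u.1) := hasFDerivWithinAt_id _ _
  have h6 := h5.congr_of_eventuallyEq (f₁ := fun z ↦ (writtenInExtChartAt I I.tangent u.1
      (fun q : M ↦ (⟨q, extend E u.2 q⟩ : TangentBundle I M)) z).1) ?_ ?_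
  · have h8 := UniqueDiffWithinAt.eq (I.uniqueDiffOn _ (Set.mem_range_self _)) h4 h6
    exact congrArg (fun L : E →L[ℝ] E ↦ L v) h8
  · filter_upwards [extChartAt_target_mem_nhdsWithin u.1] with z hz
    have := extChartAt_mk (I := I) (⟨u.1, extend E u.2 u.1⟩ : TangentBundle I M) u.1
      ((extChartAt I u.1).symm z) (extend E u.2 _) rfl
    exact (congrArg Prod.fst this).trans ((extChartAt I u.1).right_inv hz)
  · have := extChartAt_mk (I := I) (⟨u.1, extend E u.2 u.1⟩ : TangentBundle I M) u.1
      ((extChartAt I u.1).symm (extChartAt I u.1 u.1)) (extend E u.2 _) rfl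
    exact (congrArg Prod.fst this).trans
      ((extChartAt I u.1).right_inv (mem_extChartAt_target u.1))


theorem horizontalLift_eq (cov : Connection I M) (u : TangentBundle I M) :
    ∃ L : E →L[ℝ] E × E, (∀ v, (L v).1 = v) ∧
      ∀ v : E, (horizontalLift cov u v : E × E) = L v := by
  let D : E →L[ℝ] E × E :=
    mfderiv I I.tangent (fun q : M ↦ (⟨q, extend E u.2 q⟩ : TangentBundle I M)) u.1
  let C : E →L[ℝ] E := cov (extend E u.2) u.1
  refine ⟨D - (ContinuousLinearMap.inr ℝ E E).comp C, fun v ↦ ?_, fun v ↦ ?_⟩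
  · have : (D v).1 = v := sectionLift_fst u v
    simp [this]
  · exact congrArg (fun z : E × E ↦ D v - z) (verticalLift_eq u (C v))

theorem exists_liftEquiv (cov : Connection I M) (u : TangentBundle I M) :
    ∃ e : (E × E) ≃L[ℝ] E × E, ∀ p : E × E,
      e p = (horizontalLift cov u p.1 : E × E) + (verticalLift u p.2 : E × E) := by
  obtain ⟨L, hL, h⟩ := horizontalLift_eq cov u
  have hV : ∀ w : E, (verticalLift u w : E × E) = (0, w) := verticalLift_eq u
  refine ⟨ContinuousLinearEquiv.equivOfInverse
    (L.comp (ContinuousLinearMap.fst ℝ E E) +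
      (ContinuousLinearMap.inr ℝ E E).comp (ContinuousLinearMap.snd ℝ E E))
    ((ContinuousLinearMap.fst ℝ E E).prod (ContinuousLinearMap.snd ℝ E E -
      (ContinuousLinearMap.snd ℝ E E).comp (L.comp (ContinuousLinearMap.fst ℝ E E))))
    (fun p ↦ ?_) (fun p ↦ ?_), fun p ↦ ?_⟩
  · ext <;> simp [hL]
  · ext <;> simp [hL]
  · refine Eq.trans ?_ (congrArg₂ (fun a b : E × E ↦ a + b) (h p.1) (hV p.2)).symm
    simp

/-- The isomorphism `T_p M × T_p M ≃ T_u(TM)`, `(v, w) ↦ v^H + w^V`, for `u ∈ T_p M`. -/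
def liftEquiv (cov : Connection I M) (u : TangentBundle I M) :
    (TangentSpace I u.1 × TangentSpace I u.1) ≃L[ℝ] TangentSpace I.tangent u :=
  (exists_liftEquiv cov u).choose

theorem liftEquiv_apply (cov : Connection I M) (u : TangentBundle I M)
    (v w : TangentSpace I u.1) :
    liftEquiv cov u (v, w) = horizontalLift cov u v + verticalLift u w :=
  (exists_liftEquiv cov u).choose_spec (v, w)

/-- `J₁ : X^H ↦ -(J X)^H, X^V ↦ (J X)^V`, with the horizontal lifts of the Levi-Civita connection
of `g`. -/
def tangentJ₁ (g : BilinField I M) (J : EndoField I M) : EndoField I.tangent (TangentBundle I M) :=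
  fun u ↦
    let A : TangentSpace I u.1 × TangentSpace I u.1 →L[ℝ] TangentSpace I u.1 × TangentSpace I u.1 :=
      ((-J u.1) ∘L ContinuousLinearMap.fst ℝ _ _).prod (J u.1 ∘L ContinuousLinearMap.snd ℝ _ _)
    (liftEquiv (leviCivita g) u).toContinuousLinearMap ∘L A ∘L
      (liftEquiv (leviCivita g) u).symm.toContinuousLinearMap

/-- `J₂ : X^H ↦ X^V, X^V ↦ -X^H`, with the horizontal lifts of the Levi-Civita connection
of `g`. -/
def tangentJ₂ (g : BilinField I M) : EndoField I.tangent (TangentBundle I M) :=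
  fun u ↦
    let A : TangentSpace I u.1 × TangentSpace I u.1 →L[ℝ] TangentSpace I u.1 × TangentSpace I u.1 :=
      (-ContinuousLinearMap.snd ℝ _ _).prod (ContinuousLinearMap.fst ℝ _ _)
    (liftEquiv (leviCivita g) u).toContinuousLinearMap ∘L A ∘L
      (liftEquiv (leviCivita g) u).symm.toContinuousLinearMap

/-- `J₃ : X^H ↦ (J X)^V, X^V ↦ (J X)^H`, with the horizontal lifts of the Levi-Civita connection
of `g`. -/
def tangentJ₃ (g : BilinField I M) (J : EndoField I M) : EndoField I.tangent (TangentBundle I M) :=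
  fun u ↦
    let A : TangentSpace I u.1 × TangentSpace I u.1 →L[ℝ] TangentSpace I u.1 × TangentSpace I u.1 :=
      (J u.1 ∘L ContinuousLinearMap.snd ℝ _ _).prod (J u.1 ∘L ContinuousLinearMap.fst ℝ _ _)
    (liftEquiv (leviCivita g) u).toContinuousLinearMap ∘L A ∘L
      (liftEquiv (leviCivita g) u).symm.toContinuousLinearMap

/-- The complete lift of `g` to the tangent bundle:
`ĝ(X^H, Y^H) = ĝ(X^V, Y^V) = 0` and `ĝ(X^H, Y^V) = ĝ(X^V, Y^H) = g(X, Y)`. -/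
def completeLift (g : BilinField I M) : BilinField I.tangent (TangentBundle I M) :=
  fun u ↦
    let P : TangentSpace I.tangent u →L[ℝ] TangentSpace I u.1 :=
      ContinuousLinearMap.fst ℝ _ _ ∘L
        (liftEquiv (leviCivita g) u).symm.toContinuousLinearMap
    let K : TangentSpace I.tangent u →L[ℝ] TangentSpace I u.1 :=
      ContinuousLinearMap.snd ℝ _ _ ∘L
        (liftEquiv (leviCivita g) u).symm.toContinuousLinearMap
    ContinuousLinearMap.precomp ℝ K ∘L g u.1 ∘L P + ContinuousLinearMap.precomp ℝ P ∘L g u.1 ∘L K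

section Values

variable (g : BilinField I M) (J : EndoField I M) (u : TangentBundle I M) (v w : TangentSpace I u.1)

theorem verticalLift_zero : verticalLift u (0 : TangentSpace I u.1) = 0 := verticalLift_eq u 0

theorem horizontalLift_zero (cov : Connection I M) : horizontalLift cov u 0 = 0 := by
  obtain ⟨L, -, h⟩ := horizontalLift_eq cov u
  exact (h 0).trans (map_zero L)

theorem liftEquiv_symm_horizontalLift (cov : Connection I M) :
    (liftEquiv cov u).symm (horizontalLift cov u v) = (v, 0) := by
  rw [ContinuousLinearEquiv.symm_apply_eq, liftEquiv_apply, verticalLift_zero, add_zero]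

theorem liftEquiv_symm_verticalLift (cov : Connection I M) :
    (liftEquiv cov u).symm (verticalLift u v) = (0, v) := by
  rw [ContinuousLinearEquiv.symm_apply_eq, liftEquiv_apply, horizontalLift_zero, zero_add]

theorem tangentJ₁_horizontalLift : tangentJ₁ g J u (horizontalLift (leviCivita g) u v) =
    horizontalLift (leviCivita g) u (-(J u.1 v)) := by
  simp [tangentJ₁, liftEquiv_symm_horizontalLift, liftEquiv_apply, verticalLift_zero]

theorem tangentJ₁_verticalLift :
    tangentJ₁ g J u (verticalLift u v) = verticalLift u (J u.1 v) := by
  simp [tangentJ₁, liftEquiv_symm_verticalLift, liftEquiv_apply, horizontalLift_zero]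

theorem tangentJ₂_horizontalLift :
    tangentJ₂ g u (horizontalLift (leviCivita g) u v) = verticalLift u v := by
  simp [tangentJ₂, liftEquiv_symm_horizontalLift, liftEquiv_apply, horizontalLift_zero]

theorem tangentJ₂_verticalLift :
    tangentJ₂ g u (verticalLift u v) = horizontalLift (leviCivita g) u (-v) := by
  simp [tangentJ₂, liftEquiv_symm_verticalLift, liftEquiv_apply, verticalLift_zero]

theorem tangentJ₃_horizontalLift :
    tangentJ₃ g J u (horizontalLift (leviCivita g) u v) = verticalLift u (J u.1 v) := by
  simp [tangentJ₃, liftEquiv_symm_horizontalLift, liftEquiv_apply, horizontalLift_zero]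

theorem tangentJ₃_verticalLift :
    tangentJ₃ g J u (verticalLift u v) = horizontalLift (leviCivita g) u (J u.1 v) := by
  simp [tangentJ₃, liftEquiv_symm_verticalLift, liftEquiv_apply, verticalLift_zero]

theorem completeLift_horizontal_horizontal :
    completeLift g u (horizontalLift (leviCivita g) u v) (horizontalLift (leviCivita g) u w) = 0 := by
  simp [completeLift, liftEquiv_symm_horizontalLift]

theorem completeLift_vertical_vertical :
    completeLift g u (verticalLift u v) (verticalLift u w) = 0 := by
  simp [completeLift, liftEquiv_symm_verticalLift]

theorem completeLift_horizontal_vertical :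
    completeLift g u (horizontalLift (leviCivita g) u v) (verticalLift u w) = g u.1 v w := by
  simp [completeLift, liftEquiv_symm_horizontalLift, liftEquiv_symm_verticalLift]

theorem completeLift_vertical_horizontal :
    completeLift g u (verticalLift u v) (horizontalLift (leviCivita g) u w) = g u.1 v w := by
  simp [completeLift, liftEquiv_symm_horizontalLift, liftEquiv_symm_verticalLift]

end Values

end Tangent
end

noncomputable section

set_option maxSynthPendingDepth 3
set_option linter.unusedSectionVars false

section ChartFrames

variable {E : Type*} [NormedAddCommGroup E] [NormedSpace ℝ E]
  {H : Type*} [TopologicalSpace H] {I : ModelWithCorners ℝ E H}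
  {M : Type*} [TopologicalSpace M] [ChartedSpace H M] [IsManifold I ∞ M]

variable (I) in
/-- The coordinate frame at `q` of the chart centred at `x₀`, as a linear map from the model space to
the tangent space. -/
def chartFrame (x₀ q : M) : E →L[ℝ] TangentSpace I q :=
  (trivializationAt E (TangentSpace I) x₀).symmL ℝ q

variable (I) in
/-- The components at `q` of a tangent vector in the chart centred at `x₀`. -/
def chartCoord (x₀ q : M) : TangentSpace I q →L[ℝ] E :=
  (trivializationAt E (TangentSpace I) x₀).continuousLinearMapAt ℝ q

variable (I) in
/-- The vector field with constant components `a` in the chart centred at `x₀`. -/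
def chartField (x₀ : M) (a : E) : Π q : M, TangentSpace I q := fun q ↦ chartFrame I x₀ q a

variable {x₀ q : M}

theorem chartCoord_chartFrame (hq : q ∈ (chartAt H x₀).source) (a : E) :
    chartCoord I x₀ q (chartFrame I x₀ q a) = a :=
  (trivializationAt E (TangentSpace I) x₀).continuousLinearMapAt_symmL hq a

theorem chartFrame_chartCoord (hq : q ∈ (chartAt H x₀).source) (v : TangentSpace I q) :
    chartFrame I x₀ q (chartCoord I x₀ q v) = v :=
  (trivializationAt E (TangentSpace I) x₀).symmL_continuousLinearMapAt hq v

theorem chartCoord_eq_snd (hq : q ∈ (chartAt H x₀).source) (v : TangentSpace I q) :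
    chartCoord I x₀ q v = (trivializationAt E (TangentSpace I) x₀ (⟨q, v⟩ : TangentBundle I M)).2 := by
  have h := (trivializationAt E (TangentSpace I) x₀).coe_linearMapAt_of_mem (R := ℝ)
    (show q ∈ (trivializationAt E (TangentSpace I) x₀).baseSet from hq)
  exact congrFun h v

theorem chartCoord_self (x₀ : M) (v : TangentSpace I x₀) : chartCoord I x₀ x₀ v = v :=
  (chartCoord_eq_snd (mem_chart_source H x₀) v).trans (trivializationAt_snd x₀ v)

theorem extend_eq_chartField (hq : q ∈ (chartAt H x₀).source) (v : TangentSpace I x₀) :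
    extend E v q = chartField I x₀ v q := by
  refine Eq.trans ?_ (congrArg (fun w : E ↦ chartFrame I x₀ q w) (trivializationAt_snd x₀ v))
  exact ((trivializationAt E (TangentSpace I) x₀).symmₗ_apply (R := ℝ)
    (show q ∈ (trivializationAt E (TangentSpace I) x₀).baseSet from hq) _).symm

theorem extend_eventuallyEq_chartField (v : TangentSpace I x₀) :
    ∀ᶠ q in 𝓝 x₀, extend E v q = chartField I x₀ v q :=
  Filter.eventually_of_mem (chart_source_mem_nhds H x₀) fun _ hq ↦ extend_eq_chartField hq v

theorem contMDiffAt_chartField (hq : q ∈ (chartAt H x₀).source) (a : E) :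
    CMDiffAt ∞ (T% (chartField I x₀ a)) q := by
  refine ((trivializationAt E (TangentSpace I) x₀).contMDiffAt_section_iff
    (show q ∈ (trivializationAt E (TangentSpace I) x₀).baseSet from hq)).2 ?_
  refine (contMDiffAt_const (c := a)).congr_of_eventuallyEq ?_
  filter_upwards [(chartAt H x₀).open_source.mem_nhds hq] with y hy
  rw [← chartCoord_eq_snd hy]
  exact chartCoord_chartFrame hy a

theorem mdifferentiableAt_chartField (hq : q ∈ (chartAt H x₀).source) (a : E) :
    MDiffAt (T% (chartField I x₀ a)) q :=
  (contMDiffAt_chartField hq a).mdifferentiableAt (by simp)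

section Boundaryless

variable [I.Boundaryless]

theorem extChartAt_symm_mem {x : E} (hx : x ∈ (extChartAt I x₀).target) :
    (extChartAt I x₀).symm x ∈ (chartAt H x₀).source := by
  rw [← extChartAt_source I]; exact (extChartAt I x₀).map_target hx

theorem extChartAt_mem_target (hq : q ∈ (chartAt H x₀).source) :
    extChartAt I x₀ q ∈ (extChartAt I x₀).target :=
  (extChartAt I x₀).map_source (by rwa [extChartAt_source])

theorem target_mem_nhds {x : E} (hx : x ∈ (extChartAt I x₀).target) :
    (extChartAt I x₀).target ∈ 𝓝 x := (isOpen_extChartAt_target x₀).mem_nhds hx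

theorem extChartAt_symm_apply (hq : q ∈ (chartAt H x₀).source) :
    (extChartAt I x₀).symm (extChartAt I x₀ q) = q :=
  (extChartAt I x₀).left_inv (by rwa [extChartAt_source])

theorem contMDiffAt_extChartAt_symm {x : E} (hx : x ∈ (extChartAt I x₀).target) :
    ContMDiffAt 𝓘(ℝ, E) I ∞ (extChartAt I x₀).symm x :=
  (contMDiffOn_extChartAt_symm x₀).contMDiffAt (target_mem_nhds hx)

variable {F : Type*} [NormedAddCommGroup F] [NormedSpace ℝ F]

theorem ContMDiffAt.contDiffAt_chart {f : M → F} {x : E} (hx : x ∈ (extChartAt I x₀).target)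
    (hf : ContMDiffAt I 𝓘(ℝ, F) ∞ f ((extChartAt I x₀).symm x)) :
    ContDiffAt ℝ ∞ (fun x ↦ f ((extChartAt I x₀).symm x)) x :=
  contMDiffAt_iff_contDiffAt.1 (hf.comp x (contMDiffAt_extChartAt_symm hx))

theorem MDifferentiableAt.differentiableAt_chart {f : M → F} (hq : q ∈ (chartAt H x₀).source)
    (hf : MDifferentiableAt I 𝓘(ℝ, F) f q) :
    DifferentiableAt ℝ (fun x ↦ f ((extChartAt I x₀).symm x)) (extChartAt I x₀ q) := by
  rw [← extChartAt_symm_apply (I := I) hq] at hf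
  exact mdifferentiableAt_iff_differentiableAt.1 (hf.comp _
    ((contMDiffAt_extChartAt_symm (extChartAt_mem_target hq)).mdifferentiableAt (by simp)))

theorem DifferentiableAt.mdifferentiableAt_of_chart {f : M → F} (hq : q ∈ (chartAt H x₀).source)
    (hf : DifferentiableAt ℝ (fun x ↦ f ((extChartAt I x₀).symm x)) (extChartAt I x₀ q)) :
    MDifferentiableAt I 𝓘(ℝ, F) f q := by
  have h := hf.mdifferentiableAt.comp q (mdifferentiableAt_extChartAt (I := I) hq)
  refine h.congr_of_eventuallyEq ?_
  filter_upwards [(chartAt H x₀).open_source.mem_nhds hq] with y hy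
  exact congrArg f (extChartAt_symm_apply hy).symm

theorem ContDiffAt.contMDiffAt_of_chart {f : M → F} (hq : q ∈ (chartAt H x₀).source)
    (hf : ContDiffAt ℝ ∞ (fun x ↦ f ((extChartAt I x₀).symm x)) (extChartAt I x₀ q)) :
    ContMDiffAt I 𝓘(ℝ, F) ∞ f q := by
  have h := hf.contMDiffAt.comp q (contMDiffAt_extChartAt' (I := I) hq)
  refine h.congr_of_eventuallyEq ?_
  filter_upwards [(chartAt H x₀).open_source.mem_nhds hq] with y hy
  exact congrArg f (extChartAt_symm_apply hy).symm

/-- Differentiation along a coordinate field is differentiation of the coordinate expression. -/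
theorem mvfderiv_chartFrame {f : M → F} (hq : q ∈ (chartAt H x₀).source)
    (hf : MDifferentiableAt I 𝓘(ℝ, F) f q) (a : E) :
    d% f q (chartFrame I x₀ q a) =
      fderiv ℝ (fun x ↦ f ((extChartAt I x₀).symm x)) (extChartAt I x₀ q) a := by
  have hs := (contMDiffAt_extChartAt_symm (extChartAt_mem_target (I := I) hq)).mdifferentiableAt
    (by simp)
  have hf' := hf
  rw [← extChartAt_symm_apply (I := I) hq] at hf'
  have h := mfderiv_comp (extChartAt I x₀ q) hf' hs
  have e : chartFrame I x₀ q = mfderiv 𝓘(ℝ, E) I (extChartAt I x₀).symm (extChartAt I x₀ q) := by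
    refine (TangentBundle.symmL_trivializationAt hq).trans ?_
    rw [ModelWithCorners.range_eq_univ, mfderivWithin_univ]
  rw [mfderiv_eq_fderiv] at h
  have h2 := congrArg (fun L : E →L[ℝ] F ↦ L a) h
  refine Eq.trans ?_ h2.symm
  have h3 : ∀ q' : M, q' = q → ∀ w : E,
      (mfderiv I 𝓘(ℝ, F) f q' : E →L[ℝ] F) w = (mfderiv I 𝓘(ℝ, F) f q : E →L[ℝ] F) w := by
    rintro _ rfl w; rfl
  refine Eq.trans ?_ (h3 _ (extChartAt_symm_apply hq) _).symm
  exact congrArg (fun L : E →L[ℝ] E ↦ (mfderiv I 𝓘(ℝ, F) f q : E →L[ℝ] F) (L a)) e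

variable [FiniteDimensional ℝ E]

theorem mlieBracket_chartField (hq : q ∈ (chartAt H x₀).source) (a b : E) :
    mlieBracket I (chartField I x₀ a) (chartField I x₀ b) q = 0 := by
  have := FiniteDimensional.complete ℝ E
  have : IsManifold I (minSmoothness ℝ 2) M := .of_le (n := ∞) (by simp; exact ENat.LEInfty.out)
  let A : E → Π x : E, TangentSpace 𝓘(ℝ, E) x := fun c _ ↦ c
  have hA : ∀ c x, MDifferentiableAt 𝓘(ℝ, E) 𝓘(ℝ, E).tangent (T% (A c)) x := fun c x ↦
    (contMDiffAt_vectorSpace_iff_contDiffAt.2 (contDiffAt_const (c := c) (n := 1))).mdifferentiableAt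
      one_ne_zero
  have hpull : ∀ c, ∀ᶠ y in 𝓝 q, chartField I x₀ c y =
      mpullback I 𝓘(ℝ, E) (extChartAt I x₀) (A c) y := by
    intro c
    filter_upwards [(chartAt H x₀).open_source.mem_nhds hq] with y hy
    rw [mpullback_apply]
    have h1 : chartCoord I x₀ y = mfderiv I 𝓘(ℝ, E) (extChartAt I x₀) y :=
      TangentBundle.continuousLinearMapAt_trivializationAt hy
    have hinv : (mfderiv I 𝓘(ℝ, E) (extChartAt I x₀) y).IsInvertible :=
      isInvertible_mfderiv_extChartAt (by rwa [extChartAt_source])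
    obtain ⟨e, he⟩ := hinv
    rw [← he, ContinuousLinearMap.inverse_equiv]
    refine (e.symm_apply_eq.2 ?_).symm
    have h2 := chartCoord_chartFrame (I := I) hy c
    rw [h1, ← he] at h2
    exact h2.symm
  rw [Filter.EventuallyEq.mlieBracket_vectorField_eq (hpull a) (hpull b),
    ← mpullback_mlieBracket (n := ∞) (hA a _) (hA b _) (contMDiffAt_extChartAt' hq)
      (by simp; exact ENat.LEInfty.out)]
  have h0 : mlieBracket 𝓘(ℝ, E) (A a) (A b) (extChartAt I x₀ q) = 0 := by
    rw [← mlieBracketWithin_univ, mlieBracketWithin_eq_lieBracketWithin, lieBracketWithin_univ]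
    simp [lieBracket]
    rfl
  rw [mpullback_apply, h0, map_zero]

end Boundaryless

end ChartFrames

section LocalMetrics

variable {E : Type*} [NormedAddCommGroup E] [NormedSpace ℝ E]

/-- A smooth nondegenerate symmetric bilinear form depending on the point of an open set `U`. -/
structure IsLocalMetric (U : Set E) (G : E → E →L[ℝ] E →L[ℝ] ℝ) : Prop where
  isOpen : IsOpen U
  contDiffOn : ContDiffOn ℝ ∞ G U
  symm : ∀ x ∈ U, ∀ a b, G x a b = G x b a
  nondegenerate : ∀ x ∈ U, ∀ a, (∀ b, G x a b = 0) → a = 0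

/-- The Christoffel symbols of the first kind: `(a, b, c) ↦ D_a G(b,c) + D_b G(a,c) - D_c G(a,b)`. -/
def koszulForm (G : E → E →L[ℝ] E →L[ℝ] ℝ) (x : E) : E →L[ℝ] E →L[ℝ] E →L[ℝ] ℝ :=
  fderiv ℝ G x + (fderiv ℝ G x).flip -
    (ContinuousLinearMap.flipₗᵢ ℝ E E ℝ).toContinuousLinearEquiv.toContinuousLinearMap ∘L
      (fderiv ℝ G x).flip

theorem koszulForm_apply (G : E → E →L[ℝ] E →L[ℝ] ℝ) (x a b c : E) :
    koszulForm G x a b c = fderiv ℝ G x a b c + fderiv ℝ G x b a c - fderiv ℝ G x c a b := rfl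

/-- The Christoffel symbols of `G`. -/
def christoffel (G : E → E →L[ℝ] E →L[ℝ] ℝ) (x : E) : E →L[ℝ] E →L[ℝ] E :=
  (1 / 2 : ℝ) • ContinuousLinearMap.compL ℝ E (E →L[ℝ] ℝ) E (G x).inverse ∘L koszulForm G x

theorem christoffel_apply (G : E → E →L[ℝ] E →L[ℝ] ℝ) (x a b : E) :
    christoffel G x a b = (1 / 2 : ℝ) • (G x).inverse (koszulForm G x a b) := rfl

/-- `(∇_a J) b` for the connection of `G`. -/
def nablaEndo (G : E → E →L[ℝ] E →L[ℝ] ℝ) (J : E → E →L[ℝ] E) (x a b : E) : E :=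
  fderiv ℝ J x a b + christoffel G x a (J x b) - J x (christoffel G x a b)

/-- The curvature of `G`. -/
def localCurvature (G : E → E →L[ℝ] E →L[ℝ] ℝ) (x a b c : E) : E :=
  fderiv ℝ (christoffel G) x a b c - fderiv ℝ (christoffel G) x b a c
    + christoffel G x a (christoffel G x b c) - christoffel G x b (christoffel G x a c)

theorem hasFDerivAt_clm_apply₂ {F F₁ F₂ F₃ : Type*} [NormedAddCommGroup F] [NormedSpace ℝ F]
    [NormedAddCommGroup F₁] [NormedSpace ℝ F₁] [NormedAddCommGroup F₂] [NormedSpace ℝ F₂]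
    [NormedAddCommGroup F₃] [NormedSpace ℝ F₃]
    {B : F → F₁ →L[ℝ] F₂ →L[ℝ] F₃} {s : F → F₁} {t : F → F₂} {x : F}
    (hB : DifferentiableAt ℝ B x) (hs : DifferentiableAt ℝ s x) (ht : DifferentiableAt ℝ t x)
    (a : F) : fderiv ℝ (fun x ↦ B x (s x) (t x)) x a =
      fderiv ℝ B x a (s x) (t x) + B x (fderiv ℝ s x a) (t x) + B x (s x) (fderiv ℝ t x a) := by
  rw [((hB.hasFDerivAt.clm_apply hs.hasFDerivAt).clm_apply ht.hasFDerivAt).fderiv]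
  simp
  abel

theorem fderiv_clm_apply_apply {F F₁ F₂ : Type*} [NormedAddCommGroup F] [NormedSpace ℝ F]
    [NormedAddCommGroup F₁] [NormedSpace ℝ F₁] [NormedAddCommGroup F₂] [NormedSpace ℝ F₂]
    {B : F → F₁ →L[ℝ] F₂} {s : F → F₁} {x : F}
    (hB : DifferentiableAt ℝ B x) (hs : DifferentiableAt ℝ s x)
    (a : F) : fderiv ℝ (fun x ↦ B x (s x)) x a = fderiv ℝ B x a (s x) + B x (fderiv ℝ s x a) := by
  rw [(hB.hasFDerivAt.clm_apply hs.hasFDerivAt).fderiv]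
  simp
  abel

variable [FiniteDimensional ℝ E]

theorem isInvertible_of_nondegenerate {B : E →L[ℝ] E →L[ℝ] ℝ}
    (hB : ∀ a, (∀ b, B a b = 0) → a = 0) : B.IsInvertible := by
  obtain ⟨S, hS⟩ := exists_sharp B hB
  refine ⟨ContinuousLinearEquiv.equivOfInverse B S (fun a ↦ ?_) (fun φ ↦ ?_), ?_⟩
  · refine sub_eq_zero.1 (hB _ fun b ↦ ?_)
    simp [hS]
  · ext b; exact hS φ b
  · ext; rfl

namespace IsLocalMetric

variable {U : Set E} {G : E → E →L[ℝ] E →L[ℝ] ℝ} (hG : IsLocalMetric U G) {x : E} (hx : x ∈ U)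

include hG hx

theorem contDiffAt : ContDiffAt ℝ ∞ G x := hG.contDiffOn.contDiffAt (hG.isOpen.mem_nhds hx)

theorem differentiableAt : DifferentiableAt ℝ G x :=
  (hG.contDiffAt hx).differentiableAt (by simp)

theorem ext {v w : E} (h : ∀ c, G x v c = G x w c) : v = w := by
  refine sub_eq_zero.1 (hG.nondegenerate x hx _ fun c ↦ ?_)
  simp [h c]

theorem christoffel_spec (a b c : E) : 2 * G x (christoffel G x a b) c =
    fderiv ℝ G x a b c + fderiv ℝ G x b a c - fderiv ℝ G x c a b := by
  obtain ⟨e, he⟩ := isInvertible_of_nondegenerate (hG.nondegenerate x hx)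
  rw [christoffel_apply, map_smul, ← he, ContinuousLinearMap.inverse_equiv]
  simp [koszulForm_apply]

theorem eq_christoffel {a b v : E} (h : ∀ c, 2 * G x v c =
    fderiv ℝ G x a b c + fderiv ℝ G x b a c - fderiv ℝ G x c a b) : v = christoffel G x a b :=
  hG.ext hx fun c ↦ by linarith [h c, hG.christoffel_spec hx a b c]

theorem fderiv_symm (a b c : E) : fderiv ℝ G x a b c = fderiv ℝ G x a c b := by
  have h : ∀ b c, fderiv ℝ G x a b c = fderiv ℝ (fun x ↦ G x b c) x a := fun b c ↦ by
    rw [hasFDerivAt_clm_apply₂ (hG.differentiableAt hx) (differentiableAt_const b)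
      (differentiableAt_const c)]
    simp
  rw [h, h]
  refine congrArg (fun L : E →L[ℝ] ℝ ↦ L a) (Filter.EventuallyEq.fderiv_eq ?_)
  filter_upwards [hG.isOpen.mem_nhds hx] with y hy using hG.symm y hy b c

theorem christoffel_symm (a b : E) : christoffel G x a b = christoffel G x b a := by
  refine hG.eq_christoffel hx fun c ↦ ?_
  rw [hG.christoffel_spec hx, hG.fderiv_symm hx c a b]
  ring

theorem christoffel_metric (a b c : E) : fderiv ℝ G x a b c =
    G x (christoffel G x a b) c + G x b (christoffel G x a c) := by
  rw [hG.symm x hx b]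
  linarith [hG.christoffel_spec hx a b c, hG.christoffel_spec hx a c b, hG.fderiv_symm hx a b c,
    hG.fderiv_symm hx b a c, hG.fderiv_symm hx c a b]

omit hx in
theorem contDiffOn_christoffel : ContDiffOn ℝ ∞ (christoffel G) U := by
  have := FiniteDimensional.complete ℝ E
  have hD : ContDiffOn ℝ ∞ (fderiv ℝ G) U := hG.contDiffOn.fderiv_of_isOpen hG.isOpen (by simp)
  have hI : ContDiffOn ℝ ∞ (fun x ↦ (G x).inverse) U := fun x hx ↦ by
    obtain ⟨e, he⟩ := isInvertible_of_nondegenerate (hG.nondegenerate x hx)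
    have h := contDiffAt_map_inverse (𝕜 := ℝ) (n := ∞) e
    rw [he] at h
    exact (h.comp x (hG.contDiffAt hx)).contDiffWithinAt
  have happ : ∀ a b c : E, ContDiffOn ℝ ∞ (fun x ↦ fderiv ℝ G x a b c) U := fun a b c ↦
    ((hD.clm_apply contDiffOn_const).clm_apply contDiffOn_const).clm_apply contDiffOn_const
  refine contDiffOn_clm_apply.2 fun a ↦ contDiffOn_clm_apply.2 fun b ↦ ?_
  refine contDiffOn_const.smul (hI.clm_apply ?_)
  refine contDiffOn_clm_apply.2 fun c ↦ ?_
  exact ((happ a b c).add (happ b a c)).sub (happ c a b)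

theorem differentiableAt_christoffel : DifferentiableAt ℝ (christoffel G) x :=
  (hG.contDiffOn_christoffel.contDiffAt (hG.isOpen.mem_nhds hx)).differentiableAt (by simp)

theorem fderiv_christoffel_symm (a b c : E) : fderiv ℝ (christoffel G) x a b c =
    fderiv ℝ (christoffel G) x a c b := by
  have h : ∀ b c, fderiv ℝ (christoffel G) x a b c = fderiv ℝ (fun x ↦ christoffel G x b c) x a :=
    fun b c ↦ by
      rw [hasFDerivAt_clm_apply₂ (hG.differentiableAt_christoffel hx) (differentiableAt_const b)
        (differentiableAt_const c)]
      simp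
  rw [h, h]
  refine congrArg (fun L : E →L[ℝ] E ↦ L a) (Filter.EventuallyEq.fderiv_eq ?_)
  filter_upwards [hG.isOpen.mem_nhds hx] with y hy using hG.christoffel_symm hy b c

end IsLocalMetric

end LocalMetrics

section ChartExpressions

variable {E : Type*} [NormedAddCommGroup E] [NormedSpace ℝ E]
  {H : Type*} [TopologicalSpace H] {I : ModelWithCorners ℝ E H}
  {M : Type*} [TopologicalSpace M] [ChartedSpace H M] [IsManifold I ∞ M]

/-- The expression of a field of bilinear forms in the chart centred at `x₀`. -/
def locBilin (g : BilinField I M) (x₀ : M) (x : E) : E →L[ℝ] E →L[ℝ] ℝ :=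
  ContinuousLinearMap.precomp ℝ (chartFrame I x₀ ((extChartAt I x₀).symm x)) ∘L
    g ((extChartAt I x₀).symm x) ∘L chartFrame I x₀ ((extChartAt I x₀).symm x)

/-- The expression of a field of endomorphisms in the chart centred at `x₀`. -/
def locEndo (J : EndoField I M) (x₀ : M) (x : E) : E →L[ℝ] E :=
  chartCoord I x₀ ((extChartAt I x₀).symm x) ∘L J ((extChartAt I x₀).symm x) ∘L
    chartFrame I x₀ ((extChartAt I x₀).symm x)

/-- The expression of a vector field in the chart centred at `x₀`. -/
def locField (σ : Π q : M, TangentSpace I q) (x₀ : M) (x : E) : E :=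
  chartCoord I x₀ ((extChartAt I x₀).symm x) (σ ((extChartAt I x₀).symm x))

variable [I.Boundaryless] {g : BilinField I M} {J : EndoField I M} {x₀ q : M}

theorem locBilin_apply (x a b : E) : locBilin g x₀ x a b =
    g ((extChartAt I x₀).symm x) (chartFrame I x₀ _ a) (chartFrame I x₀ _ b) := rfl

theorem locEndo_apply (x a : E) : locEndo J x₀ x a =
    chartCoord I x₀ ((extChartAt I x₀).symm x) (J _ (chartFrame I x₀ _ a)) := rfl

theorem locBilin_extChartAt (hq : q ∈ (chartAt H x₀).source) (a b : E) :
    locBilin g x₀ (extChartAt I x₀ q) a b = g q (chartFrame I x₀ q a) (chartFrame I x₀ q b) := by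
  rw [locBilin_apply, extChartAt_symm_apply hq]

theorem locBilin_chartCoord (hq : q ∈ (chartAt H x₀).source) (v w : TangentSpace I q) :
    locBilin g x₀ (extChartAt I x₀ q) (chartCoord I x₀ q v) (chartCoord I x₀ q w) = g q v w := by
  rw [locBilin_extChartAt hq, chartFrame_chartCoord hq, chartFrame_chartCoord hq]

theorem locEndo_extChartAt (hq : q ∈ (chartAt H x₀).source) (a : E) :
    locEndo J x₀ (extChartAt I x₀ q) a = chartCoord I x₀ q (J q (chartFrame I x₀ q a)) := by
  rw [locEndo_apply, extChartAt_symm_apply hq]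

theorem locEndo_chartCoord (hq : q ∈ (chartAt H x₀).source) (v : TangentSpace I q) :
    locEndo J x₀ (extChartAt I x₀ q) (chartCoord I x₀ q v) = chartCoord I x₀ q (J q v) := by
  rw [locEndo_extChartAt hq, chartFrame_chartCoord hq]

theorem locField_extChartAt (σ : Π q : M, TangentSpace I q) (hq : q ∈ (chartAt H x₀).source) :
    locField σ x₀ (extChartAt I x₀ q) = chartCoord I x₀ q (σ q) := by
  rw [locField, extChartAt_symm_apply hq]

theorem locField_chartField (a : E) {x : E} (hx : x ∈ (extChartAt I x₀).target) :
    locField (chartField I x₀ a) x₀ x = a :=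
  chartCoord_chartFrame (extChartAt_symm_mem hx) a

theorem chartCoord_extend (hq : q ∈ (chartAt H x₀).source) (v : TangentSpace I x₀) :
    chartCoord I x₀ q (extend E v q) = chartCoord I x₀ x₀ v := by
  rw [extend_eq_chartField hq, chartCoord_self]
  exact chartCoord_chartFrame hq _

theorem locField_endo (σ : Π q : M, TangentSpace I q) {x : E} (hx : x ∈ (extChartAt I x₀).target) :
    locField (fun q ↦ J q (σ q)) x₀ x = locEndo J x₀ x (locField σ x₀ x) := by
  rw [locEndo_apply, locField, locField, chartFrame_chartCoord (extChartAt_symm_mem hx)]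

theorem locBilin_locField (σ τ : Π q : M, TangentSpace I q) {x : E}
    (hx : x ∈ (extChartAt I x₀).target) :
    locBilin g x₀ x (locField σ x₀ x) (locField τ x₀ x) =
      g ((extChartAt I x₀).symm x) (σ _) (τ _) := by
  have hq := extChartAt_symm_mem hx
  rw [locBilin_apply, locField, locField, chartFrame_chartCoord hq, chartFrame_chartCoord hq]

theorem mdifferentiableAt_iff_locField {σ : Π q : M, TangentSpace I q}
    (hq : q ∈ (chartAt H x₀).source) :
    MDiffAt (T% σ) q ↔ DifferentiableAt ℝ (locField σ x₀) (extChartAt I x₀ q) := by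
  rw [(trivializationAt E (TangentSpace I) x₀).mdifferentiableAt_section_iff I σ
    (show q ∈ (trivializationAt E (TangentSpace I) x₀).baseSet from hq)]
  have e : (fun x : E ↦ (trivializationAt E (TangentSpace I) x₀
      (⟨(extChartAt I x₀).symm x, σ ((extChartAt I x₀).symm x)⟩ : TangentBundle I M)).2)
      =ᶠ[𝓝 (extChartAt I x₀ q)] locField σ x₀ := by
    filter_upwards [target_mem_nhds (extChartAt_mem_target hq)] with x hx
    exact (chartCoord_eq_snd (extChartAt_symm_mem hx) _).symm
  refine ⟨fun h ↦ ?_, fun h ↦ ?_⟩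
  · exact (MDifferentiableAt.differentiableAt_chart hq h).congr_of_eventuallyEq e.symm
  · exact DifferentiableAt.mdifferentiableAt_of_chart hq (h.congr_of_eventuallyEq e)

variable [FiniteDimensional ℝ E]

theorem BilinField.IsSmooth.contDiffOn_locBilin (hg : g.IsSmooth) (x₀ : M) :
    ContDiffOn ℝ ∞ (locBilin g x₀) (extChartAt I x₀).target := by
  refine contDiffOn_clm_apply.2 fun a ↦ contDiffOn_clm_apply.2 fun b ↦ fun x hx ↦ ?_
  have hq := extChartAt_symm_mem hx
  have h := ContMDiffAt.clm_bundle_apply₂ (b := fun x : M ↦ x) (F₃ := ℝ)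
    (E₃ := Bundle.Trivial M ℝ) (hg ((extChartAt I x₀).symm x)) (contMDiffAt_chartField hq a)
    (contMDiffAt_chartField hq b)
  simp only [contMDiffAt_totalSpace] at h
  exact (ContMDiffAt.contDiffAt_chart hx h.2).contDiffWithinAt

theorem EndoField.IsSmooth.contDiffOn_locEndo (hJ : J.IsSmooth) (x₀ : M) :
    ContDiffOn ℝ ∞ (locEndo J x₀) (extChartAt I x₀).target := by
  refine contDiffOn_clm_apply.2 fun a ↦ fun x hx ↦ ?_
  have hq := extChartAt_symm_mem hx
  have h := ContMDiffAt.clm_bundle_apply (b := fun x : M ↦ x) (hJ ((extChartAt I x₀).symm x))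
    (contMDiffAt_chartField hq a)
  rw [(trivializationAt E (TangentSpace I) x₀).contMDiffAt_section_iff
    (show _ ∈ (trivializationAt E (TangentSpace I) x₀).baseSet from hq)] at h
  refine ((ContMDiffAt.contDiffAt_chart hx h).congr_of_eventuallyEq ?_).contDiffWithinAt
  filter_upwards [target_mem_nhds hx] with y hy
  exact chartCoord_eq_snd (extChartAt_symm_mem hy) _

theorem EndoField.IsSmooth.mdiffAt (hJ : J.IsSmooth) {σ : Π q : M, TangentSpace I q}
    (hσ : MDiffAt (T% σ) q) : MDiffAt (T% (fun q ↦ J q (σ q))) q :=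
  MDifferentiableAt.clm_bundle_apply (b := fun x : M ↦ x)
    ((hJ q).mdifferentiableAt (by simp)) hσ

theorem BilinField.isSmooth_of_contDiffAt
    (h : ∀ x₀ : M, ContDiffAt ℝ ∞ (locBilin g x₀) (extChartAt I x₀ x₀)) : g.IsSmooth := by
  intro x₀
  refine (contMDiffAt_hom_bundle _).2 ⟨contMDiffAt_id, ?_⟩
  refine ContDiffAt.contMDiffAt_of_chart (mem_chart_source H x₀)
    ((h x₀).congr_of_eventuallyEq ?_)
  filter_upwards [target_mem_nhds (extChartAt_mem_target (mem_chart_source H x₀))] with x hx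
  have hq := extChartAt_symm_mem hx
  ext a b
  refine (inCoordinates_apply_eq₂ (E₃ := Bundle.Trivial M ℝ) hq hq (Set.mem_univ _)).trans ?_
  have e : ∀ c : E, (trivializationAt E (TangentSpace I) x₀).symm ((extChartAt I x₀).symm x) c =
      chartFrame I x₀ ((extChartAt I x₀).symm x) c := fun c ↦
    ((trivializationAt E (TangentSpace I) x₀).symmₗ_apply (R := ℝ) hq c).symm
  rw [e, e]
  simp [locBilin_apply]

theorem EndoField.isSmooth_of_contDiffAt
    (h : ∀ x₀ : M, ContDiffAt ℝ ∞ (locEndo J x₀) (extChartAt I x₀ x₀)) : J.IsSmooth := by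
  intro x₀
  refine (contMDiffAt_hom_bundle _).2 ⟨contMDiffAt_id, ?_⟩
  exact ContDiffAt.contMDiffAt_of_chart (mem_chart_source H x₀) (h x₀)

theorem IsMetric.isLocalMetric (hg : IsMetric g) (x₀ : M) :
    IsLocalMetric (extChartAt I x₀).target (locBilin g x₀) where
  isOpen := isOpen_extChartAt_target x₀
  contDiffOn := hg.smooth.contDiffOn_locBilin x₀
  symm x _ a b := hg.symm ((extChartAt I x₀).symm x) (chartFrame I x₀ _ a)
    (chartFrame I x₀ _ b)
  nondegenerate x hx a h := by
    have hq := extChartAt_symm_mem hx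
    have h0 : chartFrame I x₀ ((extChartAt I x₀).symm x) a = 0 := by
      refine hg.nondegenerate ((extChartAt I x₀).symm x) _ fun w ↦ ?_
      rw [← chartFrame_chartCoord hq w]
      exact h _
    rw [← chartCoord_chartFrame (I := I) hq a, h0, map_zero]

/-- The Levi-Civita connection in a chart. -/
theorem chartCoord_leviCivita (hg : IsMetric g) (hq : q ∈ (chartAt H x₀).source)
    {σ : Π q : M, TangentSpace I q} (hσ : MDiffAt (T% σ) q) (v : TangentSpace I q) :
    chartCoord I x₀ q (leviCivita g σ q v) =
      fderiv ℝ (locField σ x₀) (extChartAt I x₀ q) (chartCoord I x₀ q v) +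
        christoffel (locBilin g x₀) (extChartAt I x₀ q) (chartCoord I x₀ q v)
          (chartCoord I x₀ q (σ q)) := by
  have hL := hg.isLeviCivita_leviCivita
  have hG := hg.isLocalMetric x₀
  have hx := extChartAt_mem_target (I := I) hq
  have hmet : ∀ {σ τ : Π q : M, TangentSpace I q}, MDiffAt (T% σ) q → MDiffAt (T% τ) q → ∀ a : E,
      fderiv ℝ (locBilin g x₀) (extChartAt I x₀ q) a (chartCoord I x₀ q (σ q))
          (chartCoord I x₀ q (τ q)) +
        locBilin g x₀ (extChartAt I x₀ q) (fderiv ℝ (locField σ x₀) (extChartAt I x₀ q) a)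
          (chartCoord I x₀ q (τ q)) +
        locBilin g x₀ (extChartAt I x₀ q) (chartCoord I x₀ q (σ q))
          (fderiv ℝ (locField τ x₀) (extChartAt I x₀ q) a) =
      locBilin g x₀ (extChartAt I x₀ q)
          (chartCoord I x₀ q (leviCivita g σ q (chartFrame I x₀ q a))) (chartCoord I x₀ q (τ q)) +
        locBilin g x₀ (extChartAt I x₀ q) (chartCoord I x₀ q (σ q))
          (chartCoord I x₀ q (leviCivita g τ q (chartFrame I x₀ q a))) := by
    intro σ τ hσ hτ a
    have h := hL.metric hσ hτ (chartFrame I x₀ q a)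
    rw [mvfderiv_chartFrame hq (hg.smooth.mdiffAt hσ hτ)] at h
    rw [locBilin_chartCoord hq, locBilin_chartCoord hq, ← h, ← locField_extChartAt σ hq,
      ← locField_extChartAt τ hq, ← hasFDerivAt_clm_apply₂ (hG.differentiableAt hx)
      ((mdifferentiableAt_iff_locField hq).1 hσ) ((mdifferentiableAt_iff_locField hq).1 hτ)]
    refine congrArg (fun L : E →L[ℝ] ℝ ↦ L a) (Filter.EventuallyEq.fderiv_eq ?_)
    filter_upwards [target_mem_nhds hx] with y hy using locBilin_locField σ τ hy
  have hfield : ∀ a : E, fderiv ℝ (locField (chartField I x₀ a) x₀) (extChartAt I x₀ q) = 0 := by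
    intro a
    rw [Filter.EventuallyEq.fderiv_eq (f := fun _ ↦ a) ?_]
    · simp
    · filter_upwards [target_mem_nhds hx] with y hy using locField_chartField a hy
  have hcoord : ∀ a : E, chartCoord I x₀ q (chartField I x₀ a q) = a := chartCoord_chartFrame hq
  have hframe : ∀ a b : E,
      chartCoord I x₀ q (leviCivita g (chartField I x₀ b) q (chartFrame I x₀ q a)) =
        christoffel (locBilin g x₀) (extChartAt I x₀ q) a b := by
    have htor : ∀ a b : E,
        chartCoord I x₀ q (leviCivita g (chartField I x₀ b) q (chartFrame I x₀ q a)) =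
          chartCoord I x₀ q (leviCivita g (chartField I x₀ a) q (chartFrame I x₀ q b)) := by
      intro a b
      have h := hL.torsionFree (mdifferentiableAt_chartField hq a)
        (mdifferentiableAt_chartField hq b)
      rw [mlieBracket_chartField hq] at h
      exact congrArg (chartCoord I x₀ q) (sub_eq_zero.1 h)
    have hm : ∀ a b c : E, fderiv ℝ (locBilin g x₀) (extChartAt I x₀ q) a b c =
        locBilin g x₀ (extChartAt I x₀ q)
          (chartCoord I x₀ q (leviCivita g (chartField I x₀ b) q (chartFrame I x₀ q a))) c +
        locBilin g x₀ (extChartAt I x₀ q)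
          (chartCoord I x₀ q (leviCivita g (chartField I x₀ c) q (chartFrame I x₀ q a))) b := by
      intro a b c
      have h := hmet (mdifferentiableAt_chartField hq b) (mdifferentiableAt_chartField hq c) a
      rw [hfield, hfield, hcoord, hcoord] at h
      simp only [zero_apply, map_zero, add_zero] at h
      rw [h, hG.symm _ hx b]
    intro a b
    refine hG.eq_christoffel hx fun c ↦ ?_
    rw [hm a b c, hm b a c, hm c a b, htor b a, htor c a, htor c b]
    ring
  refine hG.ext hx fun c ↦ ?_
  have h := hmet hσ (mdifferentiableAt_chartField hq c) (chartCoord I x₀ q v)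
  rw [hfield, hcoord, hframe, chartFrame_chartCoord hq, hG.christoffel_metric hx] at h
  simp only [zero_apply, map_zero, add_zero] at h
  rw [map_add, add_apply]
  linarith

/-- `∇ J` in a chart. -/
theorem chartCoord_covDerivEndo (hg : IsMetric g) (hJ : J.IsSmooth)
    (hq : q ∈ (chartAt H x₀).source) (v w : TangentSpace I q) :
    chartCoord I x₀ q (covDerivEndo g J q v w) =
      nablaEndo (locBilin g x₀) (locEndo J x₀) (extChartAt I x₀ q) (chartCoord I x₀ q v)
        (chartCoord I x₀ q w) := by
  have hx := extChartAt_mem_target (I := I) hq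
  have hσ : MDiffAt (T% (extend E w)) q := mdifferentiableAt_extend I E w
  have e : locField (fun q ↦ J q (extend E w q)) x₀ =ᶠ[𝓝 (extChartAt I x₀ q)]
      fun x ↦ locEndo J x₀ x (locField (extend E w) x₀ x) := by
    filter_upwards [target_mem_nhds hx] with y hy using locField_endo _ hy
  have hd : DifferentiableAt ℝ (locEndo J x₀) (extChartAt I x₀ q) :=
    ((hJ.contDiffOn_locEndo x₀).contDiffAt (target_mem_nhds hx)).differentiableAt (by simp)
  rw [covDerivEndo, map_sub, ← locEndo_chartCoord (J := J) hq, chartCoord_leviCivita hg hq (hJ.mdiffAt hσ),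
    chartCoord_leviCivita hg hq hσ, e.fderiv_eq,
    fderiv_clm_apply_apply hd ((mdifferentiableAt_iff_locField hq).1 hσ),
    locField_extChartAt _ hq, extend_apply_self, ← locEndo_chartCoord hq, nablaEndo, map_add]
  abel

theorem mlieBracket_extend (v w : TangentSpace I q) :
    mlieBracket I (extend E v) (extend E w) q = 0 :=
  (Filter.EventuallyEq.mlieBracket_vectorField_eq (extend_eventuallyEq_chartField v)
    (extend_eventuallyEq_chartField w)).trans (mlieBracket_chartField (mem_chart_source H q) _ _)

/-- The curvature in a chart, at its centre. -/
theorem chartCoord_curvature (hg : IsMetric g) (v w z : TangentSpace I x₀) :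
    chartCoord I x₀ x₀ (curvature g x₀ v w z) =
      localCurvature (locBilin g x₀) (extChartAt I x₀ x₀) (chartCoord I x₀ x₀ v)
        (chartCoord I x₀ x₀ w) (chartCoord I x₀ x₀ z) := by
  have hq := mem_chart_source H x₀
  have hx := extChartAt_mem_target (I := I) hq
  have hG := hg.isLocalMetric x₀
  have hchr := hG.differentiableAt_christoffel hx
  have e : ∀ w z : TangentSpace I x₀,
      locField (fun y ↦ leviCivita g (extend E z) y (extend E w y)) x₀
      =ᶠ[𝓝 (extChartAt I x₀ x₀)]
      fun x ↦ christoffel (locBilin g x₀) x (chartCoord I x₀ x₀ w) (chartCoord I x₀ x₀ z) := by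
    intro w z
    filter_upwards [target_mem_nhds hx] with y hy
    have hy' := extChartAt_symm_mem hy
    have hz : MDiffAt (T% (extend E z)) ((extChartAt I x₀).symm y) :=
      (mdifferentiableAt_chartField hy' (chartCoord I x₀ x₀ z)).congr_of_eventuallyEq <| by
        filter_upwards [(chartAt H x₀).open_source.mem_nhds hy'] with q hq
        rw [extend_eq_chartField hq, chartCoord_self]
    have ez : locField (extend E z) x₀ =ᶠ[𝓝 y] fun _ ↦ chartCoord I x₀ x₀ z := by
      filter_upwards [target_mem_nhds hy] with t ht
      exact chartCoord_extend (extChartAt_symm_mem ht) z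
    rw [locField, chartCoord_leviCivita hg hy' hz, (extChartAt I x₀).right_inv hy, ez.fderiv_eq,
      chartCoord_extend hy', chartCoord_extend hy']
    simp
  have hd : ∀ w z : TangentSpace I x₀,
      MDiffAt (T% (fun y ↦ leviCivita g (extend E z) y (extend E w y))) x₀ := fun w z ↦
    (mdifferentiableAt_iff_locField hq).2 <|
      ((hchr.clm_apply (differentiableAt_const _)).clm_apply
        (differentiableAt_const _)).congr_of_eventuallyEq (e w z)
  have hval : ∀ w z : TangentSpace I x₀,
      chartCoord I x₀ x₀ (leviCivita g (extend E z) x₀ (extend E w x₀)) =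
        christoffel (locBilin g x₀) (extChartAt I x₀ x₀) (chartCoord I x₀ x₀ w)
          (chartCoord I x₀ x₀ z) := fun w z ↦ by
    exact (locField_extChartAt (fun y ↦ leviCivita g (extend E z) y (extend E w y)) hq).symm.trans
      (e w z).self_of_nhds
  rw [curvature, mlieBracket_extend, map_zero, sub_zero, map_sub, chartCoord_leviCivita hg hq (hd _ _),
    chartCoord_leviCivita hg hq (hd _ _), (e _ _).fderiv_eq, (e _ _).fderiv_eq,
    hasFDerivAt_clm_apply₂ hchr (differentiableAt_const _) (differentiableAt_const _),
    hasFDerivAt_clm_apply₂ hchr (differentiableAt_const _) (differentiableAt_const _), hval, hval]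
  simp [localCurvature]
  abel

/-- The exterior derivative of a 2-form in a chart, at its centre. -/
theorem extDerivTwo_eq {η : BilinField I M} (hη : η.IsSmooth) (u v w : TangentSpace I x₀) :
    extDerivTwo η x₀ u v w =
      fderiv ℝ (locBilin η x₀) (extChartAt I x₀ x₀) (chartCoord I x₀ x₀ u) (chartCoord I x₀ x₀ v)
          (chartCoord I x₀ x₀ w)
        - fderiv ℝ (locBilin η x₀) (extChartAt I x₀ x₀) (chartCoord I x₀ x₀ v)
          (chartCoord I x₀ x₀ u) (chartCoord I x₀ x₀ w)
        + fderiv ℝ (locBilin η x₀) (extChartAt I x₀ x₀) (chartCoord I x₀ x₀ w)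
          (chartCoord I x₀ x₀ u) (chartCoord I x₀ x₀ v) := by
  have hq := mem_chart_source H x₀
  have hx := extChartAt_mem_target (I := I) hq
  have hdiff : DifferentiableAt ℝ (locBilin η x₀) (extChartAt I x₀ x₀) :=
    ((hη.contDiffOn_locBilin x₀).contDiffAt (target_mem_nhds hx)).differentiableAt (by simp)
  have h : ∀ u v w : TangentSpace I x₀, d% (fun y ↦ η y (extend E v y) (extend E w y)) x₀ u =
      fderiv ℝ (locBilin η x₀) (extChartAt I x₀ x₀) (chartCoord I x₀ x₀ u) (chartCoord I x₀ x₀ v)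
          (chartCoord I x₀ x₀ w) := by
    intro u v w
    have h1 := mvfderiv_chartFrame hq (hη.mdiffAt (mdifferentiableAt_extend I E v)
      (mdifferentiableAt_extend I E w)) (chartCoord I x₀ x₀ u)
    rw [chartFrame_chartCoord hq] at h1
    have h2 := hasFDerivAt_clm_apply₂ hdiff (differentiableAt_const (chartCoord I x₀ x₀ v))
      (differentiableAt_const (chartCoord I x₀ x₀ w)) (chartCoord I x₀ x₀ u)
    simp only [fderiv_fun_const, Pi.zero_apply, zero_apply, map_zero, add_zero] at h2
    rw [h1, ← h2]
    refine congrArg (fun L : E →L[ℝ] ℝ ↦ L _) (Filter.EventuallyEq.fderiv_eq ?_)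
    filter_upwards [target_mem_nhds hx] with y hy
    rw [locBilin_apply, extend_eq_chartField (extChartAt_symm_mem hy),
      extend_eq_chartField (extChartAt_symm_mem hy), chartCoord_self, chartCoord_self]
    rfl
  rw [extDerivTwo]
  simp only [mlieBracket_extend, map_zero, zero_apply, sub_zero, add_zero]
  rw [h, h, h]

end ChartExpressions

section TangentBundleCharts

variable {E : Type*} [NormedAddCommGroup E] [NormedSpace ℝ E]
  {H : Type*} [TopologicalSpace H] {I : ModelWithCorners ℝ E H}
  {M : Type*} [TopologicalSpace M] [ChartedSpace H M] [IsManifold I ∞ M]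

theorem chartCoord_mfderiv {E' : Type*} [NormedAddCommGroup E'] [NormedSpace ℝ E']
    {H' : Type*} [TopologicalSpace H'] {I' : ModelWithCorners ℝ E' H'}
    {N : Type*} [TopologicalSpace N] [ChartedSpace H' N] {f : N → M} {q : N} {x₀ p : M}
    (hf : MDifferentiableAt I' I f q) (hp : f q = p) (hq : p ∈ (chartAt H x₀).source)
    (v : TangentSpace I' q) (ξ : TangentSpace I p)
    (hξ : (mfderiv I' I f q v : E) = (ξ : E)) :
    chartCoord I x₀ p ξ = d% (fun y ↦ extChartAt I x₀ (f y)) q v := by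
  subst hp
  have h := mfderiv_comp q (mdifferentiableAt_extChartAt (I := I) hq) hf
  have e : chartCoord I x₀ (f q) = mfderiv I 𝓘(ℝ, E) (extChartAt I x₀) (f q) :=
    TangentBundle.continuousLinearMapAt_trivializationAt hq
  have h2 := congrArg (fun L : E' →L[ℝ] E ↦ L v) h
  refine Eq.trans ?_ h2.symm
  have hξ' : ξ = mfderiv I' I f q v := hξ.symm
  rw [hξ']
  exact congrArg (fun L : E →L[ℝ] E ↦ L (mfderiv I' I f q v)) e

theorem tangent_mem_source {u₀ u : TangentBundle I M} (hu : u.1 ∈ (chartAt H u₀.1).source) :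
    u ∈ (chartAt (ModelProd H E) u₀).source := (TangentBundle.mem_chart_source_iff _ _).2 hu

theorem tangent_extChartAt {u₀ u : TangentBundle I M} (hu : u.1 ∈ (chartAt H u₀.1).source) :
    extChartAt I.tangent u₀ u = (extChartAt I u₀.1 u.1, chartCoord I u₀.1 u.1 u.2) := by
  rw [chartCoord_eq_snd hu]
  exact extChartAt_mk u₀ u₀.1 u.1 u.2 rfl

theorem tangent_extChartAt_target (u₀ : TangentBundle I M) :
    (extChartAt I.tangent u₀).target = (extChartAt I u₀.1).target ×ˢ Set.univ := by
  have h := FiberBundle.extChartAt_target (IB := I) u₀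
  refine Eq.trans h ?_
  congr 1
  refine Set.inter_eq_left.2 fun x hx ↦ ?_
  have := (extChartAt I u₀.1).map_target hx
  rwa [extChartAt_source] at this

variable [I.Boundaryless]

theorem chartCoord_verticalLift {u₀ u : TangentBundle I M} (hu : u.1 ∈ (chartAt H u₀.1).source)
    (w : TangentSpace I u.1) :
    chartCoord I.tangent u₀ u (verticalLift u w) = (0, chartCoord I u₀.1 u.1 w) := by
  have e : (fun t : ℝ ↦ (trivializationAt E (TangentSpace I) u.1
      (⟨u.1, u.2 + t • w⟩ : TangentBundle I M)).2) = fun t ↦ (u.2 : E) + t • (w : E) := by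
    ext t
    exact trivializationAt_snd _ _
  have hd : MDifferentiableAt 𝓘(ℝ, ℝ) I.tangent
      (fun t : ℝ ↦ (⟨u.1, u.2 + t • w⟩ : TangentBundle I M)) 0 := by
    refine (mdifferentiableAt_totalSpace (IB := I) _).2 ⟨mdifferentiableAt_const, ?_⟩
    rw [e]
    exact (hasDerivAt_line (F := E) (u.2 : E) (u.2 : E) (w : E)).differentiableAt.snd.mdifferentiableAt
  have h := chartCoord_mfderiv (x₀ := u₀) hd (p := u) (by simp) (tangent_mem_source hu) (1 : ℝ)
    (verticalLift u w) rfl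
  rw [h]
  have e2 : (fun t : ℝ ↦ extChartAt I.tangent u₀ (⟨u.1, u.2 + t • w⟩ : TangentBundle I M)) =
      fun t ↦ (extChartAt I u₀.1 u.1, chartCoord I u₀.1 u.1 u.2 + t • chartCoord I u₀.1 u.1 w) := by
    ext1 t
    rw [tangent_extChartAt (u := ⟨u.1, u.2 + t • w⟩) hu, map_add, map_smul]
  have h3 : HasDerivAt (fun t : ℝ ↦ (extChartAt I u₀.1 u.1,
      chartCoord I u₀.1 u.1 u.2 + t • chartCoord I u₀.1 u.1 w)) (0, chartCoord I u₀.1 u.1 w) 0 :=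
    hasDerivAt_line _ _ _
  rw [e2]
  have h4 : mfderiv 𝓘(ℝ, ℝ) 𝓘(ℝ, E × E) (fun t : ℝ ↦ (extChartAt I u₀.1 u.1,
      chartCoord I u₀.1 u.1 u.2 + t • chartCoord I u₀.1 u.1 w)) 0 = fderiv ℝ (fun t : ℝ ↦
      (extChartAt I u₀.1 u.1, chartCoord I u₀.1 u.1 u.2 + t • chartCoord I u₀.1 u.1 w)) 0 :=
    mfderiv_eq_fderiv
  refine (congrArg (fun L : ℝ →L[ℝ] E × E ↦ L 1) h4).trans ?_
  exact h3.deriv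

variable [FiniteDimensional ℝ E] {g : BilinField I M} {J : EndoField I M}

theorem chartCoord_horizontalLift (hg : IsMetric g) {u₀ u : TangentBundle I M}
    (hu : u.1 ∈ (chartAt H u₀.1).source) (v : TangentSpace I u.1) :
    chartCoord I.tangent u₀ u (horizontalLift (leviCivita g) u v) =
      (chartCoord I u₀.1 u.1 v, -christoffel (locBilin g u₀.1) (extChartAt I u₀.1 u.1)
        (chartCoord I u₀.1 u.1 v) (chartCoord I u₀.1 u.1 u.2)) := by
  have hd : MDifferentiableAt I I.tangent
      (fun q : M ↦ (⟨q, extend E u.2 q⟩ : TangentBundle I M)) u.1 :=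
    mdifferentiableAt_extend I E u.2
  have h := chartCoord_mfderiv (x₀ := u₀) hd (p := u) (by simp) (tangent_mem_source hu) v
    (show TangentSpace I.tangent u from mfderiv I I.tangent
      (fun q : M ↦ (⟨q, extend E u.2 q⟩ : TangentBundle I M)) u.1 v) rfl
  have hd' : MDifferentiableAt I 𝓘(ℝ, E × E)
      (fun q ↦ extChartAt I.tangent u₀ (⟨q, extend E u.2 q⟩ : TangentBundle I M)) u.1 := by
    refine MDifferentiableAt.comp u.1 (mdifferentiableAt_extChartAt ?_) hd
    exact tangent_mem_source hu
  have h1 := mvfderiv_chartFrame hu hd' (chartCoord I u₀.1 u.1 v)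
  rw [chartFrame_chartCoord hu] at h1
  have hx := extChartAt_mem_target (I := I) hu
  have e : (fun x ↦ extChartAt I.tangent u₀ (⟨(extChartAt I u₀.1).symm x,
      extend E u.2 ((extChartAt I u₀.1).symm x)⟩ : TangentBundle I M))
      =ᶠ[𝓝 (extChartAt I u₀.1 u.1)] fun x ↦ (x, locField (extend E u.2) u₀.1 x) := by
    filter_upwards [target_mem_nhds hx] with x hx
    rw [tangent_extChartAt (u := ⟨(extChartAt I u₀.1).symm x, _⟩) (extChartAt_symm_mem hx),
      (extChartAt I u₀.1).right_inv hx]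
    rfl
  have hs := (mdifferentiableAt_iff_locField hu).1 (mdifferentiableAt_extend I E u.2)
  have hf := ((hasFDerivAt_id (𝕜 := ℝ) (extChartAt I u₀.1 u.1)).prodMk hs.hasFDerivAt).fderiv
  have h2 : fderiv ℝ (fun x ↦ (x, locField (extend E u.2) u₀.1 x)) (extChartAt I u₀.1 u.1)
      (chartCoord I u₀.1 u.1 v) = (chartCoord I u₀.1 u.1 v,
        fderiv ℝ (locField (extend E u.2) u₀.1) (extChartAt I u₀.1 u.1)
          (chartCoord I u₀.1 u.1 v)) := congrArg (fun L : E →L[ℝ] E × E ↦ L _) hf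
  rw [e.fderiv_eq, h2] at h1
  have h3 := chartCoord_leviCivita hg hu (mdifferentiableAt_extend I E u.2) v
  rw [extend_apply_self] at h3
  refine (map_sub (chartCoord I.tangent u₀ u) _ _).trans ?_
  rw [chartCoord_verticalLift hu, h3]
  refine (congrArg (fun z : E × E ↦ z - _) (h.trans h1)).trans ?_
  simp

theorem chartCoord_liftEquiv (hg : IsMetric g) {u₀ u : TangentBundle I M}
    (hu : u.1 ∈ (chartAt H u₀.1).source) (v w : TangentSpace I u.1) :
    chartCoord I.tangent u₀ u (liftEquiv (leviCivita g) u (v, w)) =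
      (chartCoord I u₀.1 u.1 v, chartCoord I u₀.1 u.1 w -
        christoffel (locBilin g u₀.1) (extChartAt I u₀.1 u.1)
          (chartCoord I u₀.1 u.1 v) (chartCoord I u₀.1 u.1 u.2)) := by
  rw [liftEquiv_apply, map_add, chartCoord_horizontalLift hg hu, chartCoord_verticalLift hu]
  simp only [Prod.mk_add_mk, add_zero]
  congr 1
  abel

theorem liftEquiv_symm_chartFrame (hg : IsMetric g) {u₀ u : TangentBundle I M}
    (hu : u.1 ∈ (chartAt H u₀.1).source) (α : E × E) :
    (liftEquiv (leviCivita g) u).symm (chartFrame I.tangent u₀ u α) =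
      (chartFrame I u₀.1 u.1 α.1, chartFrame I u₀.1 u.1 (α.2 +
        christoffel (locBilin g u₀.1) (extChartAt I u₀.1 u.1) α.1
          (chartCoord I u₀.1 u.1 u.2))) := by
  rw [ContinuousLinearEquiv.symm_apply_eq]
  have hu' := tangent_mem_source hu
  rw [← chartFrame_chartCoord (I := I.tangent) hu' (liftEquiv (leviCivita g) u _),
    chartCoord_liftEquiv hg hu, chartCoord_chartFrame hu, chartCoord_chartFrame hu]
  simp

theorem tangent_extChartAt_symm (u₀ : TangentBundle I M) {x : E}
    (hx : x ∈ (extChartAt I u₀.1).target) (y : E) :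
    ((extChartAt I.tangent u₀).symm (x, y)).1 ∈ (chartAt H u₀.1).source ∧
      x = extChartAt I u₀.1 ((extChartAt I.tangent u₀).symm (x, y)).1 ∧
      y = chartCoord I u₀.1 ((extChartAt I.tangent u₀).symm (x, y)).1
        ((extChartAt I.tangent u₀).symm (x, y)).2 := by
  have hz : (x, y) ∈ (extChartAt I.tangent u₀).target := by
    rw [tangent_extChartAt_target]; exact ⟨hx, trivial⟩
  have hu : ((extChartAt I.tangent u₀).symm (x, y)).1 ∈ (chartAt H u₀.1).source :=
    (TangentBundle.mem_chart_source_iff _ _).1 (extChartAt_symm_mem hz)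
  have h1 := tangent_extChartAt hu
  rw [(extChartAt I.tangent u₀).right_inv hz, Prod.ext_iff] at h1
  exact ⟨hu, h1⟩

/-- The complete lift in a chart. -/
theorem locBilin_completeLift (hg : IsMetric g) (u₀ : TangentBundle I M) {x y : E}
    (hx : x ∈ (extChartAt I u₀.1).target) (α β : E × E) :
    locBilin (completeLift g) u₀ (x, y) α β =
      locBilin g u₀.1 x α.1 (β.2 + christoffel (locBilin g u₀.1) x β.1 y) +
        locBilin g u₀.1 x (α.2 + christoffel (locBilin g u₀.1) x α.1 y) β.1 := by
  obtain ⟨hu, h1⟩ := tangent_extChartAt_symm u₀ hx y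
  rw [locBilin_apply]
  simp only [completeLift, add_apply, ContinuousLinearMap.comp_apply,
    ContinuousLinearMap.precomp_apply, ContinuousLinearEquiv.coe_coe,
    liftEquiv_symm_chartFrame hg hu, ← h1.1, ← h1.2]
  conv_rhs => rw [h1.1]
  rw [locBilin_extChartAt hu, locBilin_extChartAt hu, ← h1.1]
  rfl

/-- `J₁` in a chart. -/
theorem locEndo_tangentJ₁ (hg : IsMetric g) (u₀ : TangentBundle I M) {x y : E}
    (hx : x ∈ (extChartAt I u₀.1).target) (α : E × E) :
    locEndo (tangentJ₁ g J) u₀ (x, y) α =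
      (-locEndo J u₀.1 x α.1, locEndo J u₀.1 x (α.2 + christoffel (locBilin g u₀.1) x α.1 y) +
        christoffel (locBilin g u₀.1) x (locEndo J u₀.1 x α.1) y) := by
  obtain ⟨hu, h1, h2⟩ := tangent_extChartAt_symm u₀ hx y
  have h : ∀ u (v : TangentSpace I u.1 × TangentSpace I u.1), v = (liftEquiv (leviCivita g) u).symm
      (chartFrame I.tangent u₀ u α) → tangentJ₁ g J u (chartFrame I.tangent u₀ u α) =
        liftEquiv (leviCivita g) u (-J _ v.1, J _ v.2) := by
    rintro u _ rfl; rfl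
  rw [locEndo_apply, h _ _ (liftEquiv_symm_chartFrame hg hu α).symm, chartCoord_liftEquiv hg hu]
  simp only [map_neg, neg_apply, ← locEndo_extChartAt hu, ← h1, ← h2]
  simp

/-- `J₂` in a chart. -/
theorem locEndo_tangentJ₂ (hg : IsMetric g) (u₀ : TangentBundle I M) {x y : E}
    (hx : x ∈ (extChartAt I u₀.1).target) (α : E × E) :
    locEndo (tangentJ₂ g) u₀ (x, y) α =
      (-(α.2 + christoffel (locBilin g u₀.1) x α.1 y), α.1 +
        christoffel (locBilin g u₀.1) x (α.2 + christoffel (locBilin g u₀.1) x α.1 y) y) := by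
  obtain ⟨hu, h1, h2⟩ := tangent_extChartAt_symm u₀ hx y
  have h : ∀ u (v : TangentSpace I u.1 × TangentSpace I u.1), v = (liftEquiv (leviCivita g) u).symm
      (chartFrame I.tangent u₀ u α) → tangentJ₂ g u (chartFrame I.tangent u₀ u α) =
        liftEquiv (leviCivita g) u (-v.2, v.1) := by
    rintro u _ rfl; rfl
  rw [locEndo_apply, h _ _ (liftEquiv_symm_chartFrame hg hu α).symm, chartCoord_liftEquiv hg hu]
  simp only [map_neg, neg_apply, chartCoord_chartFrame hu, ← h1, ← h2]
  simp only [sub_neg_eq_add]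

/-- `J₃` in a chart. -/
theorem locEndo_tangentJ₃ (hg : IsMetric g) (u₀ : TangentBundle I M) {x y : E}
    (hx : x ∈ (extChartAt I u₀.1).target) (α : E × E) :
    locEndo (tangentJ₃ g J) u₀ (x, y) α =
      (locEndo J u₀.1 x (α.2 + christoffel (locBilin g u₀.1) x α.1 y), locEndo J u₀.1 x α.1 -
        christoffel (locBilin g u₀.1) x
          (locEndo J u₀.1 x (α.2 + christoffel (locBilin g u₀.1) x α.1 y)) y) := by
  obtain ⟨hu, h1, h2⟩ := tangent_extChartAt_symm u₀ hx y
  have h : ∀ u (v : TangentSpace I u.1 × TangentSpace I u.1), v = (liftEquiv (leviCivita g) u).symm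
      (chartFrame I.tangent u₀ u α) → tangentJ₃ g J u (chartFrame I.tangent u₀ u α) =
        liftEquiv (leviCivita g) u (J _ v.2, J _ v.1) := by
    rintro u _ rfl; rfl
  rw [locEndo_apply, h _ _ (liftEquiv_symm_chartFrame hg hu α).symm, chartCoord_liftEquiv hg hu]
  simp only [← locEndo_extChartAt hu, ← h1, ← h2]

end TangentBundleCharts

section TangentLifts

variable {E : Type*} [NormedAddCommGroup E] [NormedSpace ℝ E]

theorem hasFDerivAt_comp_fst {F : Type*} [NormedAddCommGroup F] [NormedSpace ℝ F] {B : E → F} {x : E}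
    (hB : DifferentiableAt ℝ B x) (y : E) : HasFDerivAt (fun z : E × E ↦ B z.1)
      (fderiv ℝ B x ∘L ContinuousLinearMap.fst ℝ E E) (x, y) :=
  HasFDerivAt.comp (x, y) hB.hasFDerivAt hasFDerivAt_fst

theorem fderiv_congr_on_prod {F : Type*} [NormedAddCommGroup F] [NormedSpace ℝ F] {U : Set E}
    (hU : IsOpen U) {x : E} (hx : x ∈ U) (y : E) {f f' : E × E → F} {L : E × E →L[ℝ] F}
    (hf : ∀ x ∈ U, ∀ y, f (x, y) = f' (x, y)) (hf' : HasFDerivAt f' L (x, y)) :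
    fderiv ℝ f (x, y) = L := by
  refine (Filter.EventuallyEq.fderiv_eq ?_).trans hf'.fderiv
  filter_upwards [(hU.prod isOpen_univ).mem_nhds (show (x, y) ∈ U ×ˢ Set.univ from ⟨hx, trivial⟩)]
    with z hz using hf z.1 hz.1 z.2

/-- `Ĝ` is the complete lift of the metric `G`, in coordinates. -/
def IsTangentMetric (U : Set E) (G : E → E →L[ℝ] E →L[ℝ] ℝ)
    (Ĝ : E × E → E × E →L[ℝ] E × E →L[ℝ] ℝ) : Prop :=
  ∀ x ∈ U, ∀ y α β, Ĝ (x, y) α β = G x α.1 (β.2 + christoffel G x β.1 y) +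
    G x (α.2 + christoffel G x α.1 y) β.1

variable [FiniteDimensional ℝ E] {U : Set E} {G : E → E →L[ℝ] E →L[ℝ] ℝ}
  {Ĝ : E × E → E × E →L[ℝ] E × E →L[ℝ] ℝ} {x : E}

namespace IsLocalMetric

variable (hG : IsLocalMetric U G)

include hG

theorem contDiffOn_fderiv : ContDiffOn ℝ ∞ (fderiv ℝ G) U :=
  hG.contDiffOn.fderiv_of_isOpen hG.isOpen (by simp)

theorem differentiableAt_fderiv (hx : x ∈ U) : DifferentiableAt ℝ (fderiv ℝ G) x :=
  (hG.contDiffOn_fderiv.contDiffAt (hG.isOpen.mem_nhds hx)).differentiableAt (by simp)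

theorem fderiv_fderiv_symm (hx : x ∈ U) (s t : E) :
    fderiv ℝ (fderiv ℝ G) x s t = fderiv ℝ (fderiv ℝ G) x t s :=
  (ContDiffAt.isSymmSndFDerivAt (hG.contDiffAt hx) (by simp; exact ENat.LEInfty.out)).eq s t

theorem tangentMetric_apply (hĜ : IsTangentMetric U G Ĝ) (hx : x ∈ U) (y : E) (α β : E × E) :
    Ĝ (x, y) α β = G x α.1 β.2 + G x α.2 β.1 + fderiv ℝ G x y α.1 β.1 := by
  rw [hĜ x hx, hG.christoffel_metric hx, hG.christoffel_symm hx β.1, hG.christoffel_symm hx α.1]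
  simp
  ring

theorem contDiffOn_tangentMetric (hĜ : IsTangentMetric U G Ĝ) :
    ContDiffOn ℝ ∞ Ĝ (U ×ˢ Set.univ) := by
  have h1 : ContDiffOn ℝ ∞ (fun z : E × E ↦ G z.1) (U ×ˢ Set.univ) :=
    hG.contDiffOn.comp contDiffOn_fst fun z hz ↦ hz.1
  have h2 : ContDiffOn ℝ ∞ (fun z : E × E ↦ fderiv ℝ G z.1) (U ×ˢ Set.univ) :=
    hG.contDiffOn_fderiv.comp contDiffOn_fst fun z hz ↦ hz.1
  refine contDiffOn_clm_apply.2 fun α ↦ contDiffOn_clm_apply.2 fun β ↦ ?_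
  refine ContDiffOn.congr ?_ fun z hz ↦ hG.tangentMetric_apply hĜ hz.1 z.2 α β
  exact (((h1.clm_apply contDiffOn_const).clm_apply contDiffOn_const).add
    ((h1.clm_apply contDiffOn_const).clm_apply contDiffOn_const)).add
    (((h2.clm_apply contDiffOn_snd).clm_apply contDiffOn_const).clm_apply contDiffOn_const)

theorem tangentMetric (hĜ : IsTangentMetric U G Ĝ) : IsLocalMetric (U ×ˢ Set.univ) Ĝ where
  isOpen := hG.isOpen.prod isOpen_univ
  contDiffOn := hG.contDiffOn_tangentMetric hĜ
  symm := by
    rintro ⟨x, y⟩ ⟨hx, -⟩ α β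
    rw [hG.tangentMetric_apply hĜ hx, hG.tangentMetric_apply hĜ hx, hG.symm x hx α.1,
      hG.symm x hx α.2, hG.fderiv_symm hx]
    ring
  nondegenerate := by
    rintro ⟨x, y⟩ ⟨hx, -⟩ α h
    have h1 : α.1 = 0 := hG.nondegenerate x hx _ fun b ↦ by
      simpa [hG.tangentMetric_apply hĜ hx] using h (0, b)
    have h2 : α.2 = 0 := hG.nondegenerate x hx _ fun b ↦ by
      simpa [hG.tangentMetric_apply hĜ hx, h1] using h (b, 0)
    exact Prod.ext h1 h2

theorem fderiv_tangentMetric (hĜ : IsTangentMetric U G Ĝ) (hx : x ∈ U) (y : E) (γ α β : E × E) :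
    fderiv ℝ Ĝ (x, y) γ α β = fderiv ℝ G x γ.1 α.1 β.2 + fderiv ℝ G x γ.1 α.2 β.1 +
      fderiv ℝ (fderiv ℝ G) x γ.1 y α.1 β.1 + fderiv ℝ G x γ.2 α.1 β.1 := by
  have hd := (hG.tangentMetric hĜ).differentiableAt (x := (x, y)) ⟨hx, trivial⟩
  have h1 := hasFDerivAt_clm_apply₂ hd (differentiableAt_const α) (differentiableAt_const β) γ
  simp only [fderiv_fun_const, Pi.zero_apply, zero_apply, map_zero, add_zero] at h1
  have hG1 := hasFDerivAt_comp_fst (hG.differentiableAt hx) y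
  have hG2 := hasFDerivAt_comp_fst (hG.differentiableAt_fderiv hx) y
  have hc := fun c : E ↦ hasFDerivAt_const (𝕜 := ℝ) c (x, y)
  rw [← h1, fderiv_congr_on_prod hG.isOpen hx y
    (fun x hx y ↦ hG.tangentMetric_apply hĜ hx y α β)
    ((((hG1.clm_apply (hc _)).clm_apply (hc _)).add ((hG1.clm_apply (hc _)).clm_apply (hc _))).add
      (((hG2.clm_apply hasFDerivAt_snd).clm_apply (hc _)).clm_apply (hc _)))]
  simp
  ring

theorem christoffel_spec_fderiv (hx : x ∈ U) (y a b c : E) :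
    2 * (fderiv ℝ G x y (christoffel G x a b) c + G x (fderiv ℝ (christoffel G) x y a b) c) =
      fderiv ℝ (fderiv ℝ G) x y a b c + fderiv ℝ (fderiv ℝ G) x y b a c
        - fderiv ℝ (fderiv ℝ G) x y c a b := by
  have hD := (hG.differentiableAt_fderiv hx).hasFDerivAt
  have hΓ := (hG.differentiableAt_christoffel hx).hasFDerivAt
  have hG' := (hG.differentiableAt hx).hasFDerivAt
  have hc := fun c : E ↦ hasFDerivAt_const (𝕜 := ℝ) c x
  have h1 := ((hG'.clm_apply ((hΓ.clm_apply (hc a)).clm_apply (hc b))).clm_apply (hc c)).const_mul 2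
  have h2 := ((((hD.clm_apply (hc a)).clm_apply (hc b)).clm_apply (hc c)).add
    (((hD.clm_apply (hc b)).clm_apply (hc a)).clm_apply (hc c))).sub
    (((hD.clm_apply (hc c)).clm_apply (hc a)).clm_apply (hc b))
  have e := h1.congr_of_eventuallyEq (f₁ := fun x ↦ fderiv ℝ G x a b c + fderiv ℝ G x b a c
    - fderiv ℝ G x c a b) <| by
      filter_upwards [hG.isOpen.mem_nhds hx] with z hz using (hG.christoffel_spec hz a b c).symm
  have := congrArg (fun L : E →L[ℝ] ℝ ↦ L y) (e.unique h2)
  simp at this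
  linarith

/-- The Levi-Civita connection of the complete lift. -/
theorem christoffel_tangentMetric (hĜ : IsTangentMetric U G Ĝ) (hx : x ∈ U) (y : E) (α β : E × E) :
    christoffel Ĝ (x, y) α β = (christoffel G x α.1 β.1, christoffel G x α.1 β.2 +
      christoffel G x α.2 β.1 + fderiv ℝ (christoffel G) x y α.1 β.1) := by
  refine ((hG.tangentMetric hĜ).eq_christoffel (x := (x, y)) ⟨hx, trivial⟩ fun γ ↦ ?_).symm
  rw [hG.tangentMetric_apply hĜ hx, hG.fderiv_tangentMetric hĜ hx, hG.fderiv_tangentMetric hĜ hx,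
    hG.fderiv_tangentMetric hĜ hx]
  simp only [map_add, add_apply]
  rw [hG.fderiv_fderiv_symm hx α.1, hG.fderiv_fderiv_symm hx β.1, hG.fderiv_fderiv_symm hx γ.1]
  linarith [hG.christoffel_spec hx α.1 β.1 γ.2, hG.christoffel_spec hx α.1 β.2 γ.1,
    hG.christoffel_spec hx α.2 β.1 γ.1, hG.christoffel_spec_fderiv hx y α.1 β.1 γ.1,
    hG.fderiv_symm hx γ.1 β.2 α.1]

end IsLocalMetric

end TangentLifts

section TangentEndomorphisms

variable {E : Type*} [NormedAddCommGroup E] [NormedSpace ℝ E]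

/-- `Ĵ` is the endomorphism field `J₁` of the tangent bundle, in coordinates. -/
def IsTangentJ₁ (U : Set E) (G : E → E →L[ℝ] E →L[ℝ] ℝ) (J : E → E →L[ℝ] E)
    (Ĵ : E × E → E × E →L[ℝ] E × E) : Prop :=
  ∀ x ∈ U, ∀ y α, Ĵ (x, y) α = (-J x α.1,
    J x (α.2 + christoffel G x α.1 y) + christoffel G x (J x α.1) y)

/-- `Ĵ` is the endomorphism field `J₂` of the tangent bundle, in coordinates. -/
def IsTangentJ₂ (U : Set E) (G : E → E →L[ℝ] E →L[ℝ] ℝ)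
    (Ĵ : E × E → E × E →L[ℝ] E × E) : Prop :=
  ∀ x ∈ U, ∀ y α, Ĵ (x, y) α = (-(α.2 + christoffel G x α.1 y),
    α.1 + christoffel G x (α.2 + christoffel G x α.1 y) y)

/-- `Ĵ` is the endomorphism field `J₃` of the tangent bundle, in coordinates. -/
def IsTangentJ₃ (U : Set E) (G : E → E →L[ℝ] E →L[ℝ] ℝ) (J : E → E →L[ℝ] E)
    (Ĵ : E × E → E × E →L[ℝ] E × E) : Prop :=
  ∀ x ∈ U, ∀ y α, Ĵ (x, y) α = (J x (α.2 + christoffel G x α.1 y),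
    J x α.1 - christoffel G x (J x (α.2 + christoffel G x α.1 y)) y)

variable [FiniteDimensional ℝ E] {U : Set E} {G : E → E →L[ℝ] E →L[ℝ] ℝ} {J : E → E →L[ℝ] E}
  {Ĝ : E × E → E × E →L[ℝ] E × E →L[ℝ] ℝ} {Ĵ : E × E → E × E →L[ℝ] E × E} {x : E}

namespace IsLocalMetric

variable (hG : IsLocalMetric U G)

include hG

theorem contDiffOn_christoffel_fst :
    ContDiffOn ℝ ∞ (fun z : E × E ↦ christoffel G z.1) (U ×ˢ Set.univ) :=
  hG.contDiffOn_christoffel.comp contDiffOn_fst fun _ hz ↦ hz.1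

theorem contDiffOn_tangentJ₁ (hJ : ContDiffOn ℝ ∞ J U) (hĴ : IsTangentJ₁ U G J Ĵ) :
    ContDiffOn ℝ ∞ Ĵ (U ×ˢ Set.univ) := by
  have h1 : ContDiffOn ℝ ∞ (fun z : E × E ↦ J z.1) (U ×ˢ Set.univ) :=
    hJ.comp contDiffOn_fst fun z hz ↦ hz.1
  have h2 := hG.contDiffOn_christoffel_fst
  refine contDiffOn_clm_apply.2 fun α ↦ ContDiffOn.congr ?_ fun z hz ↦ hĴ _ hz.1 z.2 α
  have hJα := h1.clm_apply (contDiffOn_const (c := α.1))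
  exact hJα.neg.prodMk ((h1.clm_apply (contDiffOn_const.add
    ((h2.clm_apply contDiffOn_const).clm_apply contDiffOn_snd))).add
    ((h2.clm_apply hJα).clm_apply contDiffOn_snd))

theorem contDiffOn_tangentJ₂ (hĴ : IsTangentJ₂ U G Ĵ) : ContDiffOn ℝ ∞ Ĵ (U ×ˢ Set.univ) := by
  have h2 := hG.contDiffOn_christoffel_fst
  refine contDiffOn_clm_apply.2 fun α ↦ ContDiffOn.congr ?_ fun z hz ↦ hĴ _ hz.1 z.2 α
  have hα := (contDiffOn_const (c := α.2)).add
    ((h2.clm_apply (contDiffOn_const (c := α.1))).clm_apply contDiffOn_snd)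
  exact hα.neg.prodMk (contDiffOn_const.add ((h2.clm_apply hα).clm_apply contDiffOn_snd))

theorem contDiffOn_tangentJ₃ (hJ : ContDiffOn ℝ ∞ J U) (hĴ : IsTangentJ₃ U G J Ĵ) :
    ContDiffOn ℝ ∞ Ĵ (U ×ˢ Set.univ) := by
  have h1 : ContDiffOn ℝ ∞ (fun z : E × E ↦ J z.1) (U ×ˢ Set.univ) :=
    hJ.comp contDiffOn_fst fun z hz ↦ hz.1
  have h2 := hG.contDiffOn_christoffel_fst
  refine contDiffOn_clm_apply.2 fun α ↦ ContDiffOn.congr ?_ fun z hz ↦ hĴ _ hz.1 z.2 α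
  have hα := h1.clm_apply ((contDiffOn_const (c := α.2)).add
    ((h2.clm_apply (contDiffOn_const (c := α.1))).clm_apply contDiffOn_snd))
  exact hα.prodMk ((h1.clm_apply contDiffOn_const).sub
    ((h2.clm_apply hα).clm_apply contDiffOn_snd))

omit hG in
theorem fderiv_apply_of_contDiffOn {F : Type*} [NormedAddCommGroup F] [NormedSpace ℝ F]
    {V : Set F} (hV : IsOpen V) {K : F → F →L[ℝ] F} (hK : ContDiffOn ℝ ∞ K V) {z : F} (hz : z ∈ V)
    (γ α : F) : fderiv ℝ K z γ α = fderiv ℝ (fun z ↦ K z α) z γ := by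
  rw [fderiv_clm_apply_apply ((hK.contDiffAt (hV.mem_nhds hz)).differentiableAt (by simp))
    (differentiableAt_const α)]
  simp

variable (hx : x ∈ U)
include hx

theorem fderiv_tangentJ₁ (hJ : ContDiffOn ℝ ∞ J U) (hĴ : IsTangentJ₁ U G J Ĵ) (y : E)
    (γ α : E × E) : fderiv ℝ Ĵ (x, y) γ α = (-fderiv ℝ J x γ.1 α.1,
      fderiv ℝ J x γ.1 (α.2 + christoffel G x α.1 y) +
        J x (fderiv ℝ (christoffel G) x γ.1 α.1 y + christoffel G x α.1 γ.2) +
        (fderiv ℝ (christoffel G) x γ.1 (J x α.1) y + christoffel G x (fderiv ℝ J x γ.1 α.1) y +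
          christoffel G x (J x α.1) γ.2)) := by
  have hJ' := hasFDerivAt_comp_fst
    ((hJ.contDiffAt (hG.isOpen.mem_nhds hx)).differentiableAt (by simp)) y
  have hΓ := hasFDerivAt_comp_fst (hG.differentiableAt_christoffel hx) y
  have hc := fun c : E ↦ hasFDerivAt_const (𝕜 := ℝ) c (x, y)
  have hJα := hJ'.clm_apply (hc α.1)
  rw [fderiv_apply_of_contDiffOn (hG.isOpen.prod isOpen_univ) (hG.contDiffOn_tangentJ₁ hJ hĴ)
    ⟨hx, trivial⟩, fderiv_congr_on_prod hG.isOpen hx y (fun x hx y ↦ hĴ x hx y α)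
    (hJα.neg.prodMk ((hJ'.clm_apply ((hc α.2).add
      ((hΓ.clm_apply (hc α.1)).clm_apply hasFDerivAt_snd))).add
      ((hΓ.clm_apply hJα).clm_apply hasFDerivAt_snd)))]
  ext
  · simp
  · simp
    abel

theorem fderiv_tangentJ₂ (hĴ : IsTangentJ₂ U G Ĵ) (y : E) (γ α : E × E) :
    fderiv ℝ Ĵ (x, y) γ α =
      (-(fderiv ℝ (christoffel G) x γ.1 α.1 y + christoffel G x α.1 γ.2),
        fderiv ℝ (christoffel G) x γ.1 (α.2 + christoffel G x α.1 y) y +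
          christoffel G x (fderiv ℝ (christoffel G) x γ.1 α.1 y + christoffel G x α.1 γ.2) y +
          christoffel G x (α.2 + christoffel G x α.1 y) γ.2) := by
  have hΓ := hasFDerivAt_comp_fst (hG.differentiableAt_christoffel hx) y
  have hc := fun c : E ↦ hasFDerivAt_const (𝕜 := ℝ) c (x, y)
  have hα := (hc α.2).add ((hΓ.clm_apply (hc α.1)).clm_apply hasFDerivAt_snd)
  rw [fderiv_apply_of_contDiffOn (hG.isOpen.prod isOpen_univ) (hG.contDiffOn_tangentJ₂ hĴ)
    ⟨hx, trivial⟩, fderiv_congr_on_prod hG.isOpen hx y (fun x hx y ↦ hĴ x hx y α)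
    (hα.neg.prodMk ((hc α.1).add ((hΓ.clm_apply hα).clm_apply hasFDerivAt_snd)))]
  ext
  · simp
    abel
  · simp
    abel

theorem fderiv_tangentJ₃ (hJ : ContDiffOn ℝ ∞ J U) (hĴ : IsTangentJ₃ U G J Ĵ) (y : E)
    (γ α : E × E) : fderiv ℝ Ĵ (x, y) γ α =
      (fderiv ℝ J x γ.1 (α.2 + christoffel G x α.1 y) +
        J x (fderiv ℝ (christoffel G) x γ.1 α.1 y + christoffel G x α.1 γ.2),
      fderiv ℝ J x γ.1 α.1 -
        (fderiv ℝ (christoffel G) x γ.1 (J x (α.2 + christoffel G x α.1 y)) y +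
          christoffel G x (fderiv ℝ J x γ.1 (α.2 + christoffel G x α.1 y) +
            J x (fderiv ℝ (christoffel G) x γ.1 α.1 y + christoffel G x α.1 γ.2)) y +
          christoffel G x (J x (α.2 + christoffel G x α.1 y)) γ.2)) := by
  have hJ' := hasFDerivAt_comp_fst
    ((hJ.contDiffAt (hG.isOpen.mem_nhds hx)).differentiableAt (by simp)) y
  have hΓ := hasFDerivAt_comp_fst (hG.differentiableAt_christoffel hx) y
  have hc := fun c : E ↦ hasFDerivAt_const (𝕜 := ℝ) c (x, y)
  have hα := hJ'.clm_apply ((hc α.2).add ((hΓ.clm_apply (hc α.1)).clm_apply hasFDerivAt_snd))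
  rw [fderiv_apply_of_contDiffOn (hG.isOpen.prod isOpen_univ) (hG.contDiffOn_tangentJ₃ hJ hĴ)
    ⟨hx, trivial⟩, fderiv_congr_on_prod hG.isOpen hx y (fun x hx y ↦ hĴ x hx y α)
    (hα.prodMk ((hJ'.clm_apply (hc α.1)).sub ((hΓ.clm_apply hα).clm_apply hasFDerivAt_snd)))]
  ext
  · simp
    abel
  · simp
    abel

/-- `J₂` is parallel if `G` is flat. -/
theorem nablaEndo_tangentJ₂ (hĜ : IsTangentMetric U G Ĝ) (hĴ : IsTangentJ₂ U G Ĵ)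
    (hflat : ∀ a b c, localCurvature G x a b c = 0) (y : E) (γ α : E × E) :
    nablaEndo Ĝ Ĵ (x, y) γ α = 0 := by
  obtain ⟨s, t⟩ := γ
  obtain ⟨a, b⟩ := α
  have hR : ∀ v : E, fderiv ℝ (christoffel G) x s v y + christoffel G x s (christoffel G x v y) =
      fderiv ℝ (christoffel G) x y s v + christoffel G x (christoffel G x s v) y := by
    intro v
    have h := hflat s y v
    rw [localCurvature, hG.fderiv_christoffel_symm hx s y v, hG.christoffel_symm hx y v,
      hG.christoffel_symm hx y] at h
    linear_combination (norm := module) h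
  rw [nablaEndo, hG.fderiv_tangentJ₂ hx hĴ, hG.christoffel_tangentMetric hĜ hx,
    hG.christoffel_tangentMetric hĜ hx, hĴ x hx, hĴ x hx]
  have h1 := hR a
  have h2 := hR (b + christoffel G x a y)
  have h3 := congrArg (fun e ↦ christoffel G x e y) h1
  have e1 := hG.christoffel_symm hx t a
  have e2 := hG.christoffel_symm hx t b
  have e3 := hG.christoffel_symm hx t (christoffel G x a y)
  have e4 := congrArg (fun e ↦ christoffel G x e y) e1
  simp only [map_add, add_apply] at h2 h3 e4
  ext
  · simp only [map_add, map_neg, Prod.fst_add, Prod.fst_sub, Prod.fst_zero]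
    linear_combination (norm := module) e1 - h1
  · simp only [map_add, map_neg, add_apply, Prod.snd_add, Prod.snd_sub, Prod.snd_zero]
    linear_combination (norm := module) h2 + h3 - e2 - e3 - e4

theorem nablaEndo_tangentJ₁_vertical_left (hĜ : IsTangentMetric U G Ĝ) (hJ : ContDiffOn ℝ ∞ J U)
    (hĴ : IsTangentJ₁ U G J Ĵ) (y t : E) (α : E × E) : nablaEndo Ĝ Ĵ (x, y) (0, t) α = 0 := by
  rw [nablaEndo, hG.fderiv_tangentJ₁ hx hJ hĴ, hG.christoffel_tangentMetric hĜ hx,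
    hG.christoffel_tangentMetric hĜ hx, hĴ x hx, hĴ x hx]
  have e1 := hG.christoffel_symm hx t (J x α.1)
  have e2 := congrArg (J x) (hG.christoffel_symm hx t α.1)
  ext
  · simp
  · simp
    linear_combination (norm := module) - e1 - e2

theorem nablaEndo_tangentJ₁_vertical_right (hĜ : IsTangentMetric U G Ĝ) (hJ : ContDiffOn ℝ ∞ J U)
    (hĴ : IsTangentJ₁ U G J Ĵ) (y w : E) (γ : E × E) :
    nablaEndo Ĝ Ĵ (x, y) γ (0, w) = (0, nablaEndo G J x γ.1 w) := by
  rw [nablaEndo, hG.fderiv_tangentJ₁ hx hJ hĴ, hG.christoffel_tangentMetric hĜ hx,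
    hG.christoffel_tangentMetric hĜ hx, hĴ x hx, hĴ x hx, nablaEndo]
  ext <;> simp

theorem nablaEndo_tangentJ₃_vertical_left (hĜ : IsTangentMetric U G Ĝ) (hJ : ContDiffOn ℝ ∞ J U)
    (hĴ : IsTangentJ₃ U G J Ĵ) (y t : E) (α : E × E) : nablaEndo Ĝ Ĵ (x, y) (0, t) α = 0 := by
  rw [nablaEndo, hG.fderiv_tangentJ₃ hx hJ hĴ, hG.christoffel_tangentMetric hĜ hx,
    hG.christoffel_tangentMetric hĜ hx, hĴ x hx, hĴ x hx]
  have e1 := hG.christoffel_symm hx t (J x (α.2 + christoffel G x α.1 y))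
  have e2 := congrArg (J x) (hG.christoffel_symm hx t α.1)
  have e3 := congrArg (fun e ↦ christoffel G x e y) e2
  simp only [map_add, add_apply] at e1
  ext
  · simp
    linear_combination (norm := module) - e2
  · simp
    linear_combination (norm := module) e1 + e3

theorem nablaEndo_tangentJ₃_vertical_right (hĜ : IsTangentMetric U G Ĝ) (hJ : ContDiffOn ℝ ∞ J U)
    (hĴ : IsTangentJ₃ U G J Ĵ) (hflat : ∀ a b c, localCurvature G x a b c = 0) (y w : E)
    (γ : E × E) : nablaEndo Ĝ Ĵ (x, y) γ (0, w) =
      (nablaEndo G J x γ.1 w, -christoffel G x (nablaEndo G J x γ.1 w) y) := by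
  rw [nablaEndo, hG.fderiv_tangentJ₃ hx hJ hĴ, hG.christoffel_tangentMetric hĜ hx,
    hG.christoffel_tangentMetric hĜ hx, hĴ x hx, hĴ x hx, nablaEndo]
  have h := hflat γ.1 y (J x w)
  rw [localCurvature, hG.fderiv_christoffel_symm hx γ.1 y, hG.christoffel_symm hx y (J x w),
    hG.christoffel_symm hx y] at h
  have e1 := hG.christoffel_symm hx γ.2 (J x w)
  ext
  · simp
  · simp
    linear_combination (norm := module) e1 - h

end IsLocalMetric

end TangentEndomorphisms

section TwinMetric

variable {E : Type*} [NormedAddCommGroup E] [NormedSpace ℝ E] [FiniteDimensional ℝ E]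
  {U : Set E} {G h : E → E →L[ℝ] E →L[ℝ] ℝ} {J : E → E →L[ℝ] E}
  {Ĝ Ω : E × E → E × E →L[ℝ] E × E →L[ℝ] ℝ} {Ĵ : E × E → E × E →L[ℝ] E × E} {x : E}

/-- `Ω` is the exterior derivative of the 1-form `α ↦ h x y α.1` at `(x, y)`. -/
def IsExactTwoForm (U : Set E) (h : E → E →L[ℝ] E →L[ℝ] ℝ)
    (Ω : E × E → E × E →L[ℝ] E × E →L[ℝ] ℝ) : Prop :=
  ∀ x ∈ U, ∀ y α β, Ω (x, y) α β =
    h x α.2 β.1 - h x α.1 β.2 + fderiv ℝ h x α.1 y β.1 - fderiv ℝ h x β.1 y α.1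

namespace IsLocalMetric

theorem contDiffOn_exactTwoForm (hh : IsLocalMetric U h) (hΩ : IsExactTwoForm U h Ω) :
    ContDiffOn ℝ ∞ Ω (U ×ˢ Set.univ) := by
  have h1 : ContDiffOn ℝ ∞ (fun z : E × E ↦ h z.1) (U ×ˢ Set.univ) :=
    hh.contDiffOn.comp contDiffOn_fst fun z hz ↦ hz.1
  have h2 : ContDiffOn ℝ ∞ (fun z : E × E ↦ fderiv ℝ h z.1) (U ×ˢ Set.univ) :=
    hh.contDiffOn_fderiv.comp contDiffOn_fst fun z hz ↦ hz.1
  refine contDiffOn_clm_apply.2 fun α ↦ contDiffOn_clm_apply.2 fun β ↦ ?_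
  refine ContDiffOn.congr ?_ fun z hz ↦ hΩ z.1 hz.1 z.2 α β
  exact ((((h1.clm_apply contDiffOn_const).clm_apply contDiffOn_const).sub
    ((h1.clm_apply contDiffOn_const).clm_apply contDiffOn_const)).add
    (((h2.clm_apply contDiffOn_const).clm_apply contDiffOn_snd).clm_apply contDiffOn_const)).sub
    (((h2.clm_apply contDiffOn_const).clm_apply contDiffOn_snd).clm_apply contDiffOn_const)

theorem fderiv_exactTwoForm (hh : IsLocalMetric U h) (hΩ : IsExactTwoForm U h Ω) (hx : x ∈ U)
    (y : E) (γ α β : E × E) : fderiv ℝ Ω (x, y) γ α β =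
      fderiv ℝ h x γ.1 α.2 β.1 - fderiv ℝ h x γ.1 α.1 β.2 +
        (fderiv ℝ (fderiv ℝ h) x γ.1 α.1 y β.1 + fderiv ℝ h x α.1 γ.2 β.1) -
        (fderiv ℝ (fderiv ℝ h) x γ.1 β.1 y α.1 + fderiv ℝ h x β.1 γ.2 α.1) := by
  have hd : DifferentiableAt ℝ Ω (x, y) := ((hh.contDiffOn_exactTwoForm hΩ).contDiffAt
    ((hh.isOpen.prod isOpen_univ).mem_nhds ⟨hx, trivial⟩)).differentiableAt (by simp)
  have h1 := hasFDerivAt_clm_apply₂ hd (differentiableAt_const α) (differentiableAt_const β) γ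
  simp only [fderiv_fun_const, Pi.zero_apply, zero_apply, map_zero, add_zero] at h1
  have hG1 := hasFDerivAt_comp_fst (hh.differentiableAt hx) y
  have hG2 := hasFDerivAt_comp_fst (hh.differentiableAt_fderiv hx) y
  have hc := fun c : E ↦ hasFDerivAt_const (𝕜 := ℝ) c (x, y)
  rw [← h1, fderiv_congr_on_prod hh.isOpen hx y (fun x hx y ↦ hΩ x hx y α β)
    (((((hG1.clm_apply (hc α.2)).clm_apply (hc β.1)).sub
      ((hG1.clm_apply (hc α.1)).clm_apply (hc β.2))).add
      (((hG2.clm_apply (hc α.1)).clm_apply hasFDerivAt_snd).clm_apply (hc β.1))).sub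
      (((hG2.clm_apply (hc β.1)).clm_apply hasFDerivAt_snd).clm_apply (hc α.1)))]
  simp
  abel

theorem closed_exactTwoForm (hh : IsLocalMetric U h) (hΩ : IsExactTwoForm U h Ω) (hx : x ∈ U)
    (y : E) (α β γ : E × E) :
    fderiv ℝ Ω (x, y) α β γ - fderiv ℝ Ω (x, y) β α γ + fderiv ℝ Ω (x, y) γ α β = 0 := by
  simp only [hh.fderiv_exactTwoForm hΩ hx]
  rw [hh.fderiv_symm hx α.1 β.1, hh.fderiv_symm hx β.1 α.1, hh.fderiv_symm hx γ.1 α.1,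
    hh.fderiv_fderiv_symm hx β.1 α.1, hh.fderiv_fderiv_symm hx γ.1 α.1,
    hh.fderiv_fderiv_symm hx γ.1 β.1]
  ring

/-- The twin metric of a Norden structure. -/
theorem twin (hG : IsLocalMetric U G) (hJ : ContDiffOn ℝ ∞ J U)
    (hsq : ∀ x ∈ U, ∀ a, J x (J x a) = -a) (hanti : ∀ x ∈ U, ∀ a b, G x (J x a) (J x b) = -G x a b) :
    IsLocalMetric U fun x ↦ G x ∘L J x where
  isOpen := hG.isOpen
  contDiffOn := hG.contDiffOn.clm_comp hJ
  symm x hx a b := by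
    have h1 := hanti x hx (J x a) b
    rw [hsq x hx] at h1
    simp only [map_neg, neg_apply] at h1
    have h2 := hG.symm x hx a (J x b)
    simp only [ContinuousLinearMap.comp_apply]
    linarith
  nondegenerate x hx a ha := by
    have h1 := hsq x hx a
    rw [hG.nondegenerate x hx (J x a) ha, map_zero] at h1
    exact neg_eq_zero.1 h1.symm

theorem fderiv_twin (hG : IsLocalMetric U G) (hJ : ContDiffOn ℝ ∞ J U) (hx : x ∈ U)
    (hpar : ∀ a b, nablaEndo G J x a b = 0) (a b c : E) :
    fderiv ℝ (fun x ↦ G x ∘L J x) x a b c =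
      G x (J x (christoffel G x a b)) c + G x (J x b) (christoffel G x a c) := by
  have hJ' := ((hJ.contDiffAt (hG.isOpen.mem_nhds hx)).differentiableAt (by simp)).hasFDerivAt
  have h := ((hG.differentiableAt hx).hasFDerivAt.clm_comp hJ').fderiv
  have h1 := hpar a b
  rw [nablaEndo] at h1
  have h2 := congrArg (fun e ↦ G x e c) h1
  simp only [map_add, map_sub, add_apply, sub_apply, map_zero, zero_apply] at h2
  rw [h]
  simp
  rw [hG.christoffel_metric hx]
  linarith

theorem isExactTwoForm_tangentJ₁ (hG : IsLocalMetric U G) (hJ : ContDiffOn ℝ ∞ J U)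
    (hsq : ∀ x ∈ U, ∀ a, J x (J x a) = -a) (hanti : ∀ x ∈ U, ∀ a b, G x (J x a) (J x b) = -G x a b)
    (hpar : ∀ x ∈ U, ∀ a b, nablaEndo G J x a b = 0) (hĜ : IsTangentMetric U G Ĝ)
    (hĴ : IsTangentJ₁ U G J Ĵ) (hΩ : ∀ x ∈ U, ∀ y α β, Ω (x, y) α β = Ĝ (x, y) (Ĵ (x, y) α) β) :
    IsExactTwoForm U (fun x ↦ G x ∘L J x) Ω := by
  intro x hx y α β
  have h1 := (hG.twin hJ hsq hanti).symm x hx (christoffel G x β.1 y) α.1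
  have h2 := (hG.twin hJ hsq hanti).symm x hx y (christoffel G x β.1 α.1)
  have h3 := hG.christoffel_symm hx β.1 α.1
  rw [hΩ x hx, hĜ x hx, hĴ x hx, hG.fderiv_twin hJ hx (hpar x hx),
    hG.fderiv_twin hJ hx (hpar x hx), h3]
  simp only [ContinuousLinearMap.comp_apply, map_add, map_neg, add_apply, neg_apply] at h1 h2 ⊢
  linarith

end IsLocalMetric

end TwinMetric

section Traces

theorem sum_inv_gram_mul {ι F : Type*} [Fintype ι] [DecidableEq ι] [AddCommGroup F] [Module ℝ F]
    (f : F →ₗ[ℝ] F →ₗ[ℝ] ℝ) (hs : ∀ v w, f v w = f w v) (hf : ∀ v, (∀ w, f v w = 0) → v = 0)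
    (e : Module.Basis ι ℝ F) (A : F →ₗ[ℝ] F) :
    ∑ i, ∑ j, (Matrix.of fun i j ↦ f (e i) (e j))⁻¹ i j * f (A (e i)) (e j) =
      LinearMap.trace ℝ F A := by
  set P : Matrix ι ι ℝ := Matrix.of fun i j ↦ f (e i) (e j) with hP
  have hdet : IsUnit P.det := by
    refine isUnit_iff_ne_zero.2 fun h0 ↦ ?_
    obtain ⟨c, hc, hPc⟩ := Matrix.exists_mulVec_eq_zero_iff.2 h0
    refine hc ?_
    have hv : ∑ j, c j • e j = 0 := by
      refine hf _ fun w ↦ ?_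
      have : f (∑ j, c j • e j) = 0 := e.ext fun i ↦ by
        have h := congrFun hPc i
        simp only [Matrix.mulVec, dotProduct, hP, Matrix.of_apply, Pi.zero_apply] at h
        simp only [map_sum, map_smul, LinearMap.sum_apply, LinearMap.smul_apply, smul_eq_mul,
          LinearMap.zero_apply]
        rw [← h]
        exact Finset.sum_congr rfl fun j _ ↦ by rw [hs (e j), mul_comm]
      simp [this]
    exact funext (Fintype.linearIndependent_iff.1 e.linearIndependent c hv)
  have hA : ∀ i j, f (A (e i)) (e j) = ∑ k, LinearMap.toMatrix e e A k i * P j k := by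
    intro i j
    conv_lhs => rw [← e.sum_repr (A (e i))]
    simp only [map_sum, map_smul, LinearMap.sum_apply, LinearMap.smul_apply, smul_eq_mul,
      LinearMap.toMatrix_apply, hP, Matrix.of_apply]
    exact Finset.sum_congr rfl fun k _ ↦ by rw [hs (e k)]
  rw [LinearMap.trace_eq_matrix_trace ℝ e, Matrix.trace]
  refine Finset.sum_congr rfl fun i _ ↦ ?_
  have h1 : ∀ k, ∑ j, P⁻¹ i j * P j k = (1 : Matrix ι ι ℝ) i k := fun k ↦ by
    rw [← Matrix.nonsing_inv_mul P hdet, Matrix.mul_apply]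
  simp only [hA, Finset.mul_sum]
  rw [Finset.sum_comm]
  have h2 : ∀ k, ∑ j, P⁻¹ i j * (LinearMap.toMatrix e e A k i * P j k) =
      LinearMap.toMatrix e e A k i * (1 : Matrix ι ι ℝ) i k := fun k ↦ by
    rw [← h1, Finset.mul_sum]
    exact Finset.sum_congr rfl fun j _ ↦ by ring
  simp only [h2]
  simp [Matrix.one_apply]

theorem trace_prod_eq {F : Type*} [AddCommGroup F] [Module ℝ F] [Module.Finite ℝ F]
    {A : F →ₗ[ℝ] F} {B : F × F →ₗ[ℝ] F × F} (h0 : ∀ t, B (0, t) = 0)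
    (h1 : ∀ s, (B (s, 0)).1 = A s) : LinearMap.trace ℝ (F × F) B = LinearMap.trace ℝ F A := by
  have e1 : B = (B ∘ₗ LinearMap.inl ℝ F F) ∘ₗ LinearMap.fst ℝ F F := by
    ext p <;> simp [h0]
  have e2 : LinearMap.fst ℝ F F ∘ₗ B ∘ₗ LinearMap.inl ℝ F F = A := by
    ext s
    simp [h1]
  rw [e1, LinearMap.trace_comp_comm', e2]

variable {E : Type*} [NormedAddCommGroup E] [NormedSpace ℝ E] [FiniteDimensional ℝ E]
  {U : Set E} {G : E → E →L[ℝ] E →L[ℝ] ℝ} {J : E → E →L[ℝ] E}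
  {Ĝ : E × E → E × E →L[ℝ] E × E →L[ℝ] ℝ} {Ĵ : E × E → E × E →L[ℝ] E × E} {x : E}

/-- `A` is the endomorphism that corresponds to the bilinear form `(v, w) ↦ G((∇_v J) w, z)`. -/
def IsStructureEndo (G : E → E →L[ℝ] E →L[ℝ] ℝ) (J : E → E →L[ℝ] E) (x z : E)
    (A : E →L[ℝ] E) : Prop :=
  ∀ v w, G x (A v) w = G x (nablaEndo G J x v w) z

namespace IsLocalMetric

theorem exists_isStructureEndo (hG : IsLocalMetric U G) (hx : x ∈ U) (J : E → E →L[ℝ] E) (z : E) :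
    ∃ A, IsStructureEndo G J x z A := by
  obtain ⟨S, hS⟩ := exists_sharp (G x) (hG.nondegenerate x hx)
  let N : E →L[ℝ] E →L[ℝ] E := fderiv ℝ J x +
    (ContinuousLinearMap.compL ℝ E E E).flip (J x) ∘L christoffel G x -
    ContinuousLinearMap.compL ℝ E E E (J x) ∘L christoffel G x
  refine ⟨S ∘L ContinuousLinearMap.compL ℝ E E ℝ ((G x).flip z) ∘L N, fun v w ↦ ?_⟩
  rw [ContinuousLinearMap.comp_apply, hS]
  simp [N, nablaEndo]

variable (hG : IsLocalMetric U G) (hx : x ∈ U) (hĜ : IsTangentMetric U G Ĝ)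

include hG hx hĜ

theorem trace_structureEndo_tangent {y z : E} {ζ : E × E} {A : E →L[ℝ] E} {Â : E × E →L[ℝ] E × E}
    (hA : IsStructureEndo G J x z A) (hÂ : IsStructureEndo Ĝ Ĵ (x, y) ζ Â)
    (hl : ∀ t α, nablaEndo Ĝ Ĵ (x, y) (0, t) α = 0)
    (hr : ∀ s w, Ĝ (x, y) (nablaEndo Ĝ Ĵ (x, y) (s, 0) (0, w)) ζ = G x (nablaEndo G J x s w) z) :
    LinearMap.trace ℝ (E × E) Â = LinearMap.trace ℝ E A := by
  refine trace_prod_eq (fun t ↦ ?_) fun s ↦ hG.ext hx fun w ↦ ?_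
  · refine (hG.tangentMetric hĜ).nondegenerate (x, y) ⟨hx, trivial⟩ _ fun β ↦ (hÂ _ β).trans ?_
    simp [hl]
  · have h := hÂ (s, 0) (0, w)
    rw [hr, ← hA, hĜ x hx] at h
    simpa using h

end IsLocalMetric

end Traces

section LeeForm

variable {E : Type*} [NormedAddCommGroup E] [NormedSpace ℝ E] [FiniteDimensional ℝ E]
  {H : Type*} [TopologicalSpace H] {I : ModelWithCorners ℝ E H} [I.Boundaryless]
  {M : Type*} [TopologicalSpace M] [ChartedSpace H M] [IsManifold I ∞ M]
  {g : BilinField I M} {J : EndoField I M}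

theorem locBilin_self (g : BilinField I M) (x : M) (v w : TangentSpace I x) :
    locBilin g x (extChartAt I x x) v w = g x v w :=
  (congrArg₂ (fun a b : E ↦ locBilin g x (extChartAt I x x) a b) (chartCoord_self x v)
    (chartCoord_self x w)).symm.trans (locBilin_chartCoord (mem_chart_source H x) v w)

theorem covDerivEndo_eq (hg : IsMetric g) (hJ : J.IsSmooth) (x : M) (v w : TangentSpace I x) :
    covDerivEndo g J x v w =
      nablaEndo (locBilin g x) (locEndo J x) (extChartAt I x x) v w := by
  have h := chartCoord_covDerivEndo hg hJ (mem_chart_source H x) v w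
  have h1 := chartCoord_self (I := I) x
  refine (h1 _).symm.trans (h.trans ?_)
  exact congrArg₂ (fun a b : E ↦ nablaEndo (locBilin g x) (locEndo J x) (extChartAt I x x) a b)
    (h1 v) (h1 w)

theorem curvature_eq (hg : IsMetric g) (x : M) (v w z : TangentSpace I x) :
    curvature g x v w z = localCurvature (locBilin g x) (extChartAt I x x) v w z := by
  have h := chartCoord_curvature hg v w z
  have h1 := chartCoord_self (I := I) x
  refine (h1 _).symm.trans (h.trans ?_)
  exact congr (congrArg₂ (fun a b c : E ↦ localCurvature (locBilin g x) (extChartAt I x x) a b c)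
    (h1 v) (h1 w)) (h1 z)

theorem leeForm_eq_trace (hg : IsMetric g) (hJ : J.IsSmooth) (x : M) (z : TangentSpace I x)
    {A : E →L[ℝ] E} (hA : IsStructureEndo (locBilin g x) (locEndo J x) (extChartAt I x x) z A) :
    leeForm g J x z = LinearMap.trace ℝ E A := by
  let f : E →ₗ[ℝ] E →ₗ[ℝ] ℝ := ContinuousLinearMap.coeLM ℝ ∘ₗ (g x : E →L[ℝ] E →L[ℝ] ℝ).toLinearMap
  rw [← sum_inv_gram_mul f (hg.symm x) (hg.nondegenerate x) (Module.finBasis ℝ E) A]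
  refine Finset.sum_congr rfl fun i _ ↦ Finset.sum_congr rfl fun j _ ↦ congrArg _ ?_
  let e : Fin (Module.finrank ℝ E) → E := Module.finBasis ℝ E
  exact (congrArg (fun v : TangentSpace I x ↦ g x v z) (covDerivEndo_eq hg hJ x (e i) (e j))).trans
    ((locBilin_self g x _ z).symm.trans
      ((hA (e i) (e j)).symm.trans (locBilin_self g x (A (e i)) (e j))))

end LeeForm

section LiftedStructures

variable {E : Type*} [NormedAddCommGroup E] [NormedSpace ℝ E]
  {H : Type*} [TopologicalSpace H] {I : ModelWithCorners ℝ E H}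
  {M : Type*} [TopologicalSpace M] [ChartedSpace H M] [IsManifold I ∞ M]
  (g : BilinField I M) (J : EndoField I M) (u : TangentBundle I M)
  (p q : TangentSpace I u.1 × TangentSpace I u.1)

theorem completeLift_liftEquiv : completeLift g u (liftEquiv (leviCivita g) u p)
    (liftEquiv (leviCivita g) u q) = g u.1 p.1 q.2 + g u.1 p.2 q.1 := by
  simp [completeLift]

theorem tangentJ₁_liftEquiv : tangentJ₁ g J u (liftEquiv (leviCivita g) u p) =
    liftEquiv (leviCivita g) u (-J u.1 p.1, J u.1 p.2) := by
  simp [tangentJ₁]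

theorem tangentJ₂_liftEquiv : tangentJ₂ g u (liftEquiv (leviCivita g) u p) =
    liftEquiv (leviCivita g) u (-p.2, p.1) := by
  simp [tangentJ₂]

theorem tangentJ₃_liftEquiv : tangentJ₃ g J u (liftEquiv (leviCivita g) u p) =
    liftEquiv (leviCivita g) u (J u.1 p.2, J u.1 p.1) := by
  simp [tangentJ₃]

variable {g J} [FiniteDimensional ℝ E] [I.Boundaryless]

theorem extChartAt_mem_target_prod : extChartAt I.tangent u u ∈
    (extChartAt I u.1).target ×ˢ (Set.univ : Set E) := by
  rw [← tangent_extChartAt_target]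
  exact mem_extChartAt_target u

theorem target_prod_mem_nhds :
    (extChartAt I u.1).target ×ˢ (Set.univ : Set E) ∈ 𝓝 (extChartAt I.tangent u u) :=
  ((isOpen_extChartAt_target u.1).prod isOpen_univ).mem_nhds (extChartAt_mem_target_prod u)

theorem IsMetric.isTangentMetric (hg : IsMetric g) :
    IsTangentMetric (extChartAt I u.1).target (locBilin g u.1) (locBilin (completeLift g) u) :=
  fun _ hx _ α β ↦ locBilin_completeLift hg u hx α β

theorem IsMetric.isTangentJ₁ (hg : IsMetric g) : IsTangentJ₁ (extChartAt I u.1).target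
    (locBilin g u.1) (locEndo J u.1) (locEndo (tangentJ₁ g J) u) :=
  fun _ hx _ α ↦ locEndo_tangentJ₁ hg u hx α

theorem IsMetric.isTangentJ₂ (hg : IsMetric g) : IsTangentJ₂ (extChartAt I u.1).target
    (locBilin g u.1) (locEndo (tangentJ₂ g) u) :=
  fun _ hx _ α ↦ locEndo_tangentJ₂ hg u hx α

theorem IsMetric.isTangentJ₃ (hg : IsMetric g) : IsTangentJ₃ (extChartAt I u.1).target
    (locBilin g u.1) (locEndo J u.1) (locEndo (tangentJ₃ g J) u) :=
  fun _ hx _ α ↦ locEndo_tangentJ₃ hg u hx α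

theorem IsMetric.isMetric_completeLift (hg : IsMetric g) : IsMetric (completeLift g) where
  smooth := BilinField.isSmooth_of_contDiffAt fun u ↦
    ((hg.isLocalMetric u.1).contDiffOn_tangentMetric (hg.isTangentMetric u)).contDiffAt
      (target_prod_mem_nhds u)
  symm u v w := by
    obtain ⟨p, rfl⟩ := (liftEquiv (leviCivita g) u).surjective v
    obtain ⟨q, rfl⟩ := (liftEquiv (leviCivita g) u).surjective w
    rw [completeLift_liftEquiv, completeLift_liftEquiv, hg.symm _ p.1, hg.symm _ p.2, add_comm]
  nondegenerate u v h := by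
    obtain ⟨p, rfl⟩ := (liftEquiv (leviCivita g) u).surjective v
    have h1 : p.1 = 0 := hg.nondegenerate _ _ fun w ↦ by
      simpa using (completeLift_liftEquiv g u p (0, w)).symm.trans (h _)
    have h2 : p.2 = 0 := hg.nondegenerate _ _ fun w ↦ by
      simpa using (completeLift_liftEquiv g u p (w, 0)).symm.trans (h _)
    rw [show p = 0 from Prod.ext h1 h2, map_zero]

variable (hgJ : IsAlmostNorden g J)
include hgJ

theorem IsAlmostNorden.isAlmostHermitian_tangentJ₁ : IsAlmostHermitian (completeLift g) (tangentJ₁ g J) where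
  isMetric := hgJ.isMetric.isMetric_completeLift
  smooth := EndoField.isSmooth_of_contDiffAt fun u ↦
    ((hgJ.isMetric.isLocalMetric u.1).contDiffOn_tangentJ₁ (hgJ.smooth.contDiffOn_locEndo u.1)
      (hgJ.isMetric.isTangentJ₁ u)).contDiffAt (target_prod_mem_nhds u)
  sq u v := by
    obtain ⟨p, rfl⟩ := (liftEquiv (leviCivita g) u).surjective v
    rw [tangentJ₁_liftEquiv, tangentJ₁_liftEquiv]
    refine (congrArg (liftEquiv (leviCivita g) u) (Prod.ext ?_ ?_)).trans (map_neg _ p)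
    · simpa using hgJ.sq _ p.1
    · exact hgJ.sq _ p.2
  isometry u v w := by
    obtain ⟨p, rfl⟩ := (liftEquiv (leviCivita g) u).surjective v
    obtain ⟨q, rfl⟩ := (liftEquiv (leviCivita g) u).surjective w
    rw [tangentJ₁_liftEquiv, tangentJ₁_liftEquiv, completeLift_liftEquiv, completeLift_liftEquiv]
    simp [hgJ.antiIsometry]

theorem IsAlmostNorden.isAlmostNorden_tangentJ₂ : IsAlmostNorden (completeLift g) (tangentJ₂ g) where
  isMetric := hgJ.isMetric.isMetric_completeLift
  smooth := EndoField.isSmooth_of_contDiffAt fun u ↦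
    ((hgJ.isMetric.isLocalMetric u.1).contDiffOn_tangentJ₂
      (hgJ.isMetric.isTangentJ₂ u)).contDiffAt (target_prod_mem_nhds u)
  sq u v := by
    obtain ⟨p, rfl⟩ := (liftEquiv (leviCivita g) u).surjective v
    rw [tangentJ₂_liftEquiv, tangentJ₂_liftEquiv, ← map_neg]
    rfl
  antiIsometry u v w := by
    obtain ⟨p, rfl⟩ := (liftEquiv (leviCivita g) u).surjective v
    obtain ⟨q, rfl⟩ := (liftEquiv (leviCivita g) u).surjective w
    rw [tangentJ₂_liftEquiv, tangentJ₂_liftEquiv, completeLift_liftEquiv, completeLift_liftEquiv]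
    simp

theorem IsAlmostNorden.isAlmostNorden_tangentJ₃ : IsAlmostNorden (completeLift g) (tangentJ₃ g J) where
  isMetric := hgJ.isMetric.isMetric_completeLift
  smooth := EndoField.isSmooth_of_contDiffAt fun u ↦
    ((hgJ.isMetric.isLocalMetric u.1).contDiffOn_tangentJ₃ (hgJ.smooth.contDiffOn_locEndo u.1)
      (hgJ.isMetric.isTangentJ₃ u)).contDiffAt (target_prod_mem_nhds u)
  sq u v := by
    obtain ⟨p, rfl⟩ := (liftEquiv (leviCivita g) u).surjective v
    rw [tangentJ₃_liftEquiv, tangentJ₃_liftEquiv, ← map_neg]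
    exact congrArg _ (Prod.ext (hgJ.sq _ _) (hgJ.sq _ _))
  antiIsometry u v w := by
    obtain ⟨p, rfl⟩ := (liftEquiv (leviCivita g) u).surjective v
    obtain ⟨q, rfl⟩ := (liftEquiv (leviCivita g) u).surjective w
    rw [tangentJ₃_liftEquiv, tangentJ₃_liftEquiv, completeLift_liftEquiv, completeLift_liftEquiv]
    simp [hgJ.antiIsometry]

omit hgJ in
theorem IsFlat.localCurvature_eq_zero (hg : IsMetric g) (hflat : IsFlat g) (x : M) (a b c : E) :
    localCurvature (locBilin g x) (extChartAt I x x) a b c = 0 :=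
  (curvature_eq hg x a b c).symm.trans (hflat x a b c)

omit hgJ in
theorem IsParallel.nablaEndo_eq_zero (hg : IsMetric g) (hJ : J.IsSmooth) (hpar : IsParallel g J)
    (x₀ : M) {x : E} (hx : x ∈ (extChartAt I x₀).target) (a b : E) :
    nablaEndo (locBilin g x₀) (locEndo J x₀) x a b = 0 := by
  have hq := extChartAt_symm_mem hx
  have h := chartCoord_covDerivEndo hg hJ hq (chartFrame I x₀ _ a) (chartFrame I x₀ _ b)
  rw [chartCoord_chartFrame hq, chartCoord_chartFrame hq, (extChartAt I x₀).right_inv hx] at h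
  rw [← h, hpar, map_zero]

theorem IsAlmostNorden.isParallel_tangentJ₂ (hflat : IsFlat g) :
    IsParallel (completeLift g) (tangentJ₂ g) := by
  intro u v w
  have hg := hgJ.isMetric
  refine (covDerivEndo_eq hg.isMetric_completeLift hgJ.isAlmostNorden_tangentJ₂.smooth u v w).trans ?_
  have hu := tangent_extChartAt (I := I) (mem_chart_source H u.1)
  rw [hu]
  exact (hg.isLocalMetric u.1).nablaEndo_tangentJ₂ (mem_extChartAt_target u.1)
    (hg.isTangentMetric u) (hg.isTangentJ₂ u) (hflat.localCurvature_eq_zero hg u.1) _ v w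

theorem IsAlmostNorden.leeForm_tangentJ₁ (u : TangentBundle I M) (ζ : E × E) :
    leeForm (completeLift g) (tangentJ₁ g J) u ζ = leeForm g J u.1 ζ.1 := by
  have hg := hgJ.isMetric
  have hJ := hgJ.smooth.contDiffOn_locEndo u.1
  have hG := hg.isLocalMetric u.1
  have hx := mem_extChartAt_target (I := I) u.1
  have hĜ := hg.isTangentMetric u
  have hĴ := hg.isTangentJ₁ (J := J) u
  have hu := tangent_extChartAt (I := I) (mem_chart_source H u.1)
  obtain ⟨A, hA⟩ := hG.exists_isStructureEndo hx (locEndo J u.1) ζ.1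
  obtain ⟨B, hB⟩ := (hG.tangentMetric hĜ).exists_isStructureEndo
    (extChartAt_mem_target_prod u) (locEndo (tangentJ₁ g J) u) ζ
  rw [leeForm_eq_trace hg hgJ.smooth u.1 _ hA,
    leeForm_eq_trace hg.isMetric_completeLift hgJ.isAlmostHermitian_tangentJ₁.smooth u ζ hB]
  rw [hu] at hB
  refine hG.trace_structureEndo_tangent hx hĜ hA hB
    (fun t α ↦ hG.nablaEndo_tangentJ₁_vertical_left hx hĜ hJ hĴ _ t α) fun s w ↦ ?_
  rw [hG.nablaEndo_tangentJ₁_vertical_right hx hĜ hJ hĴ, hG.tangentMetric_apply hĜ hx]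
  simp

theorem IsAlmostNorden.leeForm_tangentJ₃ (hflat : IsFlat g) (u : TangentBundle I M)
    (ζ : E × E) : ∃ z : TangentSpace I u.1,
      leeForm (completeLift g) (tangentJ₃ g J) u ζ = leeForm g J u.1 z := by
  have hg := hgJ.isMetric
  have hJ := hgJ.smooth.contDiffOn_locEndo u.1
  have hG := hg.isLocalMetric u.1
  have hx := mem_extChartAt_target (I := I) u.1
  have hĜ := hg.isTangentMetric u
  have hĴ := hg.isTangentJ₃ (J := J) u
  have hR := hflat.localCurvature_eq_zero hg u.1
  have hu := tangent_extChartAt (I := I) (mem_chart_source H u.1)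
  let z : E := ζ.2 + christoffel (locBilin g u.1) (extChartAt I u.1 u.1)
    ζ.1 (chartCoord I u.1 u.1 u.2)
  obtain ⟨A, hA⟩ := hG.exists_isStructureEndo hx (locEndo J u.1) z
  obtain ⟨B, hB⟩ := (hG.tangentMetric hĜ).exists_isStructureEndo
    (extChartAt_mem_target_prod u) (locEndo (tangentJ₃ g J) u) ζ
  refine ⟨z, ?_⟩
  rw [leeForm_eq_trace hg hgJ.smooth u.1 _ hA,
    leeForm_eq_trace hg.isMetric_completeLift hgJ.isAlmostNorden_tangentJ₃.smooth u ζ hB]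
  rw [hu] at hB
  refine hG.trace_structureEndo_tangent hx hĜ hA hB
    (fun t α ↦ hG.nablaEndo_tangentJ₃_vertical_left hx hĜ hJ hĴ _ t α) fun s w ↦ ?_
  rw [hG.nablaEndo_tangentJ₃_vertical_right hx hĜ hJ hĴ hR, hĜ _ hx]
  simp [z]

omit hgJ in
theorem locBilin_twoForm (g : BilinField I M) (J : EndoField I M) (x₀ : M) {x : E}
    (hx : x ∈ (extChartAt I x₀).target) (a b : E) :
    locBilin (twoForm g J) x₀ x a b = locBilin g x₀ x (locEndo J x₀ x a) b := by
  rw [locBilin_apply, locBilin_apply, locEndo_apply, chartFrame_chartCoord (extChartAt_symm_mem hx)]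
  rfl

theorem IsAlmostNorden.isExactTwoForm (hpar : IsParallel g J) (u : TangentBundle I M) :
    ∃ h, IsLocalMetric (extChartAt I u.1).target h ∧ IsExactTwoForm (extChartAt I u.1).target h
      (locBilin (twoForm (completeLift g) (tangentJ₁ g J)) u) := by
  have hg := hgJ.isMetric
  have hJ := hgJ.smooth.contDiffOn_locEndo u.1
  have hsq : ∀ x ∈ (extChartAt I u.1).target, ∀ a,
      locEndo J u.1 x (locEndo J u.1 x a) = -a := fun x hx a ↦ by
    have hq := extChartAt_symm_mem hx
    rw [locEndo_apply, locEndo_apply, chartFrame_chartCoord hq, hgJ.sq, map_neg,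
      chartCoord_chartFrame hq]
  have hanti : ∀ x ∈ (extChartAt I u.1).target, ∀ a b, locBilin g u.1 x (locEndo J u.1 x a)
      (locEndo J u.1 x b) = -locBilin g u.1 x a b := fun x hx a b ↦ by
    have hq := extChartAt_symm_mem hx
    rw [locEndo_apply, locEndo_apply, locBilin_apply, locBilin_apply, chartFrame_chartCoord hq,
      chartFrame_chartCoord hq, hgJ.antiIsometry]
  refine ⟨_, (hg.isLocalMetric u.1).twin hJ hsq hanti,
    (hg.isLocalMetric u.1).isExactTwoForm_tangentJ₁ hJ hsq hanti
      (fun x hx ↦ hpar.nablaEndo_eq_zero hg hgJ.smooth u.1 hx) (hg.isTangentMetric u)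
      (hg.isTangentJ₁ u) fun x hx y α β ↦ locBilin_twoForm _ _ u ?_ α β⟩
  rw [tangent_extChartAt_target]
  exact ⟨hx, trivial⟩

theorem IsAlmostNorden.closed_twoForm_tangentJ₁ (hpar : IsParallel g J) (u : TangentBundle I M)
    (α β γ : TangentSpace I.tangent u) :
    extDerivTwo (twoForm (completeLift g) (tangentJ₁ g J)) u α β γ = 0 := by
  have hη : (twoForm (completeLift g) (tangentJ₁ g J)).IsSmooth :=
    BilinField.isSmooth_of_contDiffAt fun u ↦ by
      obtain ⟨h, hh, hΩ⟩ := hgJ.isExactTwoForm hpar u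
      exact (hh.contDiffOn_exactTwoForm hΩ).contDiffAt (target_prod_mem_nhds u)
  obtain ⟨h, hh, hΩ⟩ := hgJ.isExactTwoForm hpar u
  rw [extDerivTwo_eq hη]
  exact hh.closed_exactTwoForm hΩ (extChartAt_mem_target_prod u).1 _ _ _ _

end LiftedStructures

end

theorem mainTheorem10 {E : Type*} [NormedAddCommGroup E] [NormedSpace ℝ E] [FiniteDimensional ℝ E]
    {M : Type*} [TopologicalSpace M] [ChartedSpace E M] [IsManifold 𝓘(ℝ, E) ∞ M]
    (g : BilinField 𝓘(ℝ, E) M) (J : EndoField 𝓘(ℝ, E) M) (hgJ : IsAlmostNorden g J) :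
    (IsFlat g → IsParallel (completeLift g) (tangentJ₂ g)) ∧
    (IsFlat g → IsNordenW₂W₃ g J →
      IsSemiKahler (completeLift g) (tangentJ₁ g J) ∧
      IsKahlerNorden (completeLift g) (tangentJ₂ g) ∧
      IsNordenW₂W₃ (completeLift g) (tangentJ₃ g J)) ∧
    (IsKahlerNorden g J → IsAlmostKahler (completeLift g) (tangentJ₁ g J)) := by
  refine ⟨hgJ.isParallel_tangentJ₂, fun hflat hθ ↦ ⟨⟨hgJ.isAlmostHermitian_tangentJ₁, fun u ζ ↦ ?_⟩,
    ⟨hgJ.isAlmostNorden_tangentJ₂, hgJ.isParallel_tangentJ₂ hflat⟩, hgJ.isAlmostNorden_tangentJ₃, fun u ζ ↦ ?_⟩,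
    fun hK ↦ ⟨hgJ.isAlmostHermitian_tangentJ₁, hgJ.closed_twoForm_tangentJ₁ hK.2⟩⟩
  · exact (hgJ.leeForm_tangentJ₁ u ζ).trans (hθ.2 u.1 _)
  · obtain ⟨z, hz⟩ := hgJ.leeForm_tangentJ₃ hflat u ζ
    exact hz.trans (hθ.2 u.1 z)
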